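/- **Definitions.** A *weight function* is a non-decreasing $\omega:[0,\infty)\to[0,\infty)$ with $\lim_{t\to\infty}\omega(t)=\infty$. Let $\mathcal W_0$ be the set of continuous weight functions $\omega$ with $\omega=0$ on $[0,1]$, $\log t=o(\omega(t))$ as $t\to\infty$, and $y\mapsto\omega(e^y)$ convex on $\mathbb R$. For a weight function $\omega$ put $\varphi^*_\omega(x)=\sup_{y\in\mathbb R}(xy-\omega(e^y))$ for $x\ge0$ (for $\omega\in\mathcal W_0$ the supremum may be restricted to $y\ge 0$) and $W^{(\ell)}_p=\exp(\tfrac1\ell\varphi^*_\omega(\ell p))$ for $\ell>0$, $p\in\mathbb N$. For $\sigma,\tau\in\mathcal W_0$ the sequences $\mathbf W^{(\ell)}$ belonging to $\sigma$ and $\tau$ are denoted by $\mathbf S^{(\ell)}$ and $\mathbf T^{(\ell)}$, and $\frac{\mathcal M_\sigma}{\mathcal M_\tau}:=\{\mathbf S^{(\ell)}/\mathbf T^{(\ell)}:\ell>0\}$ (pointwise quotients). The growth indices $\gamma(\omega),\overline\gamma(\omega)\in[0,\infty]$ are $$\gamma(\omega)=\sup\Big\{\gamma>0:\exists K>1:\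 \limsup_{t\to\infty}\tfrac{\omega(K^\gamma t)}{\omega(t)}<K\Big\},\qquad \overline\gamma(\omega)=\inf\Big\{\gamma>0:\exists A>1:\ \liminf_{t\to\infty}\tfrac{\omega(A^\gamma t)}{\omega(t)}>A\Big\}$$ with $\sup\emptyset=0$, $\inf\emptyset=\infty$. For a positive sequence $\mathbf M$ with $M_0=1$ put $\omega_{\mathbf M}(t)=\sup_{p\in\mathbb N}\log(t^p/M_p)$ for $t\ge0$ (with $0^0=1$, $\log 0=-\infty$). A positive sequence is *normalized* if $1=M_0\le M_1$ and *log-convex* if $M_p^2\le M_{p-1}M_{p+1}$ for $p\ge1$. Write $\mathbf M\approx\mathbf N$ if $\sup_{p\ge1}(M_p/N_p)^{1/p}<\infty$ and $\sup_{p\ge1}(N_p/M_p)^{1/p}<\infty$. The *generalized upper Legendre conjugate* is $(\sigma\,\widehat\star\,\tau)(t)=\sup_{s\ge0}\{\sigma(s)-\tau(s/t)\}$ for $t>0$ and $(\sigma\,\widehat\star\,\tau)(0)=\sigma(0)-\tau(0)$; it is *well-defined* if these suprema are finite. *Weighted spaces.* For a positive sequence $w$ consider the weighted norm of, respectively, *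 $\mathcal E$ and $\mathcal B$: $\sup_{x,\alpha}|f^{(\alpha)}(x)|/w_{|\alpha|}$, with $x\in U$, $f\in C^\infty(U)$ for $\mathcal B$, where $U\subseteq\mathbb R^d$ is open, and $x\in K$, $f\in C^\infty(K)$ for $\mathcal E$, where $K\subseteq U$ is a compact set that is the closure of its interior; * $\mathcal A$: $\sup_{z\in G,\,p}|f^{(p)}(z)|/w_p$ for $f$ holomorphic on $G$, a sector (or any open subset) of the Riemann surface of the logarithm; * $\mathcal S$: $\sup_{x\in\mathbb R^d,\,k,\,\alpha}(1+|x|)^k|f^{(\alpha)}(x)|/w_{k+|\alpha|}$ for $f\in C^\infty(\mathbb R^d)$; * $\Lambda$: $\sup_p|a_p|/w_p$ for complex sequences $(a_p)_p$; * $\mathcal F$: $\sup_p|a_p|/w_p$ for formal power series $\sum_p a_px^p$ or, in the other customary normalization, $\sum_p\frac{a_p}{p!}x^p$. For a family $\mathcal M=\{\mathbf M^{(\ell)}:\ell>0\}$ of sequences let $w$ run through all sequences $(h^pM^{(\ell)}_p)_p$, $\ell,h>0$; for a weight function $\omega$ let $w$ run through all $\mathbf W^{(\ell)}$, $\ell>0$.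 The Roumieu space $\mathfrak F_{\{\cdot\}}$ is the locally convex inductive limit, and the Beurling space $\mathfrak F_{(\cdot)}$ the projective limit (the intersection), of the normed spaces of all elements with finite weighted norm; for $\mathfrak F=\mathcal E$ one takes in addition the projective limit over all $K\subseteq U$. $\mathfrak F_{[\cdot]}$ stands for $\mathfrak F_{\{\cdot\}}$ throughout or for $\mathfrak F_{(\cdot)}$ throughout. **Theorem 5.16.** Let $\sigma,\tau\in\mathcal W_0$ and assume: 1. for every $\ell>0$ a normalized log-convex positive sequence $\mathbf Q^{(\ell)}$ with $\mathbf Q^{(\ell)}\approx\mathbf S^{(\ell)}/\mathbf T^{(\ell)}$ is given, and $\mathcal Q:=\{\mathbf Q^{(\ell)}:\ell>0\}$; 2. $\tau\vartriangleleft\sigma$, i.e. $\sigma(t)=o(\tau(t))$ as $t\to\infty$; 3. $0\le\overline\gamma(\tau)<\gamma(\sigma)\le\infty$. Then $\sigma\,\widehat\star\,\tau$ and, for every $\ell>0$, $\omega_{\mathbf S^{(\ell)}}\widehat\star\,\omega_{\mathbf T^{(\ell)}}$ are well-defined weight functions that dominate the logarithm ($\log t=o(\cdot)$ as $t\to\infty$),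 and, as locally convex vector spaces, $$\forall\,\ell>0:\qquad \mathfrak F_{[\frac{\mathcal M_\sigma}{\mathcal M_\tau}]}=\mathfrak F_{[\mathcal Q]}=\mathfrak F_{[\omega_{\mathbf S^{(\ell)}}\widehat\star\,\omega_{\mathbf T^{(\ell)}}]}=\mathfrak F_{[\sigma\widehat\star\tau]}$$ for all $\mathfrak F\in\{\mathcal E,\mathcal B,\mathcal A,\mathcal S,\Lambda,\mathcal F\}$, both in the Roumieu and in the Beurling case. -/

import Mathlib

open Filter Topology Asymptotics Set
open scoped ENNReal

namespace UpperLegendre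

noncomputable section

/-! ## Weight sequences -/

/-- `M` is normalized: `1 = M₀ ≤ M₁`. -/
def IsNormalized (M : ℕ → ℝ) : Prop := M 0 = 1 ∧ M 0 ≤ M 1

/-- `M` is log-convex: `M_p² ≤ M_{p-1} M_{p+1}` for `p ≥ 1`. -/
def IsLogConvex (M : ℕ → ℝ) : Prop := ∀ p : ℕ, M (p + 1) ^ 2 ≤ M p * M (p + 2)

/-- `M ≼ N`: the supremum of `(M_p / N_p)^{1/p}` over `p ≥ 1` is finite. -/
def SeqPreceq (M N : ℕ → ℝ) : Prop :=
  BddAbove ((fun p : ℕ => (M p / N p) ^ (1 / (p : ℝ))) '' {p : ℕ | 1 ≤ p})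

/-- `M ≈ N`: equivalence of sequences. -/
def SeqEquiv (M N : ℕ → ℝ) : Prop := SeqPreceq M N ∧ SeqPreceq N M

/-! ## Weight functions

A function `[0, ∞) → [0, ∞)` is given by a function `ℝ → ℝ` of which only the values at
arguments `t ≥ 0` are ever used. -/

/-- Weight function: a non-decreasing function `[0, ∞) → [0, ∞)` tending to infinity. -/
structure IsWeightFunction (ω : ℝ → ℝ) : Prop where
  nonneg : ∀ t, 0 ≤ t → 0 ≤ ω t
  monotoneOn : MonotoneOn ω (Ici 0)
  tendsto : Tendsto ω atTop atTop

/-- The set `𝒲₀` of normalized weight functions in the sense of Braun, Meise and Taylor. -/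
structure IsBMTWeight (ω : ℝ → ℝ) : Prop extends IsWeightFunction ω where
  continuousOn : ContinuousOn ω (Ici 0)
  eq_zero : ∀ t ∈ Icc (0 : ℝ) 1, ω t = 0
  log_isLittleO : Real.log =o[atTop] ω
  convexOn : ConvexOn ℝ univ (fun y : ℝ => ω (Real.exp y))

/-- `τ ◁ σ` for weight functions, i.e. `σ(t) = o(τ(t))` as `t → ∞`. -/
def WeightTriangle (τ σ : ℝ → ℝ) : Prop := σ =o[atTop] τ

/-- The property `(P_{ω,γ})`: `limsup ω(K^γ t) / ω(t) < K` for some `K > 1`. -/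
def PropP (ω : ℝ → ℝ) (γ : ℝ) : Prop :=
  ∃ K : ℝ, 1 < K ∧
    limsup (fun t : ℝ => ((ω (K ^ γ * t) / ω t : ℝ) : EReal)) atTop < (K : EReal)

/-- The property `(P̄_{ω,γ})`: `liminf ω(A^γ t) / ω(t) > A` for some `A > 1`. -/
def PropPbar (ω : ℝ → ℝ) (γ : ℝ) : Prop :=
  ∃ A : ℝ, 1 < A ∧
    (A : EReal) < liminf (fun t : ℝ => ((ω (A ^ γ * t) / ω t : ℝ) : EReal)) atTop

/-- The growth index `γ(ω) ∈ [0, ∞]` (the supremum of the empty set is `0`). -/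
def lowerIndex (ω : ℝ → ℝ) : ℝ≥0∞ := sSup (ENNReal.ofReal '' {γ : ℝ | 0 < γ ∧ PropP ω γ})

/-- The growth index `γ̄(ω) ∈ [0, ∞]` (the infimum of the empty set is `∞`). -/
def upperIndex (ω : ℝ → ℝ) : ℝ≥0∞ := sInf (ENNReal.ofReal '' {γ : ℝ | 0 < γ ∧ PropPbar ω γ})

/-- The function `ω_M(t) = sup_p log (t^p / M_p)` associated with a sequence `M`. At `t = 0` every
term of this real supremum is `0` if `M₀ = 1`, so that `ω_M(0) = 0`, as it should be. -/
def assocFun (M : ℕ → ℝ) (t : ℝ) : ℝ := ⨆ p : ℕ, Real.log (t ^ p / M p)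

/-- The conjugate `φ*_ω(x) = sup_y (x y - ω(e^y))`. For a normalized `ω` the supremum over all
real `y` is the one over `y ≥ 0`; for other `ω` it is the usual definition. -/
def youngConj (ω : ℝ → ℝ) (x : ℝ) : ℝ := ⨆ y : ℝ, (x * y - ω (Real.exp y))

/-- The associated weight matrix, `W^(ℓ)_p = exp (φ*_ω(ℓ p) / ℓ)`. -/
def assocMatrix (ω : ℝ → ℝ) (l : ℝ) (p : ℕ) : ℝ := Real.exp (1 / l * youngConj ω (l * p))

/-- The generalized upper Legendre conjugate: the supremum of `σ(s) - τ(s/t)` over `s ≥ 0` for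
`t > 0`, and `σ(0) - τ(0)` for `t = 0`. -/
def upperConj (σ τ : ℝ → ℝ) (t : ℝ) : ℝ :=
  if t = 0 then σ 0 - τ 0 else ⨆ s : Ici (0 : ℝ), (σ s - τ (s / t))

/-- The generalized upper Legendre conjugate is well-defined: the suprema are finite. -/
def UpperConjWellDefined (σ τ : ℝ → ℝ) : Prop :=
  ∀ t : ℝ, 0 < t → BddAbove (range fun s : Ici (0 : ℝ) => σ s - τ (s / t))

/-! ## Locally convex subspaces -/

/-- A linear subspace of `V` together with a locally convex vector space topology on it. An
equality of two of these is an equality as locally convex vector spaces. -/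
@[ext]
structure LCSubspace (V : Type*) [AddCommGroup V] [Module ℂ V] where
  carrier : Submodule ℂ V
  top : TopologicalSpace carrier
  addGroup : @IsTopologicalAddGroup carrier top _
  smul : @ContinuousSMul ℂ carrier _ _ top
  locallyConvex : @LocallyConvexSpace ℝ carrier _ _ _ _ top

variable {V : Type*} [AddCommGroup V] [Module ℂ V]

/-- A subspace with the topology of a (semi)norm. -/
def ofSeminorm (W : Submodule ℂ V) (N : Seminorm ℂ W) : LCSubspace V where
  carrier := W
  top := (SeminormFamily.moduleFilterBasis (fun _ : Unit => N)).topology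
  addGroup := (SeminormFamily.moduleFilterBasis (fun _ : Unit => N)).isTopologicalAddGroup
  smul := (SeminormFamily.moduleFilterBasis (fun _ : Unit => N)).continuousSMul
  locallyConvex := by
    let : TopologicalSpace W := (SeminormFamily.moduleFilterBasis (fun _ : Unit => N)).topology
    have : IsTopologicalAddGroup W :=
      (SeminormFamily.moduleFilterBasis (fun _ : Unit => N)).isTopologicalAddGroup
    have h : WithSeminorms (𝕜 := ℂ) (E := W) (fun _ : Unit => N) := ⟨rfl⟩
    exact h.toLocallyConvexSpace

/-- Inductive limit of subspaces of `V`: their sum (which is the union for a directed system),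
with the finest locally convex vector space topology that makes all inclusions continuous. -/
def indLimit {ι : Type*} (X : ι → LCSubspace V) : LCSubspace V where
  carrier := ⨆ i, (X i).carrier
  top := sInf {t : TopologicalSpace (⨆ i, (X i).carrier : Submodule ℂ V) |
    (@IsTopologicalAddGroup _ t _ ∧ @ContinuousSMul ℂ _ _ _ t ∧
      @LocallyConvexSpace ℝ _ _ _ _ _ t) ∧
    ∀ i, @Continuous _ _ (X i).top t
      (Submodule.inclusion (le_iSup (fun i => (X i).carrier) i))}
  addGroup := topologicalAddGroup_sInf fun _ ht => ht.1.1
  smul := continuousSMul_sInf fun _ ht => ht.1.2.1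
  locallyConvex := LocallyConvexSpace.sInf fun _ ht => ht.1.2.2

/-- Projective limit along linear maps `ρ k : V → V' k`: the vectors that every `ρ k` maps into
`X k`, with the coarsest topology that makes all these maps continuous. -/
def projLimit {κ : Type*} {V' : κ → Type*} [∀ k, AddCommGroup (V' k)] [∀ k, Module ℂ (V' k)]
    (X : ∀ k, LCSubspace (V' k)) (ρ : ∀ k, V →ₗ[ℂ] V' k) : LCSubspace V :=
  let W : Submodule ℂ V := ⨅ k, (X k).carrier.comap (ρ k)
  let r : ∀ k, W →ₗ[ℂ] (X k).carrier := fun k =>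
    (ρ k).restrict fun _ hf => (Submodule.mem_iInf _).1 hf k
  { carrier := W
    top := ⨅ k, TopologicalSpace.induced (r k) (X k).top
    addGroup := topologicalAddGroup_iInf fun k => by
      let := (X k).top
      have := (X k).addGroup
      exact topologicalAddGroup_induced (r k)
    smul := continuousSMul_iInf fun k => by
      let := (X k).top
      have := (X k).smul
      exact continuousSMul_induced (r k)
    locallyConvex := LocallyConvexSpace.iInf fun k => by
      let := (X k).top
      have := (X k).locallyConvex
      exact LocallyConvexSpace.induced ((r k).restrictScalars ℝ) }

/-! ## Weighted spaces: the common construction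

Every weighted space is described by linear functionals `ev j` on `V` with degrees `deg j`, where
`j` runs through an index set `J`, and by a system of weights `w i : ℕ → (0, ∞)`, where `i` runs
through an index set `ι`. -/

variable {J : Type*}

/-- The vectors of finite weighted norm `sup_j |ev j f| / w (deg j)`. (The weights are positive in
all cases of interest; the absolute value makes the construction total.) -/
def stepSpace (deg : J → ℕ) (ev : J → V →ₗ[ℂ] ℂ) (w : ℕ → ℝ) : Submodule ℂ V where
  carrier := {f | BddAbove (range fun j => ‖ev j f‖ / |w (deg j)|)}
  zero_mem' := ⟨0, by rintro _ ⟨j, rfl⟩; simp⟩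
  add_mem' := by
    rintro f g ⟨a, ha⟩ ⟨b, hb⟩
    refine ⟨a + b, ?_⟩
    rintro _ ⟨j, rfl⟩
    refine le_trans ?_ (add_le_add (ha ⟨j, rfl⟩) (hb ⟨j, rfl⟩))
    simp only [map_add, ← add_div]
    gcongr
    exact norm_add_le _ _
  smul_mem' := by
    rintro c f ⟨a, ha⟩
    refine ⟨‖c‖ * a, ?_⟩
    rintro _ ⟨j, rfl⟩
    have := mul_le_mul_of_nonneg_left (ha ⟨j, rfl⟩) (norm_nonneg c)
    simpa [mul_div_assoc] using this

/-- The weighted norm `sup_j |ev j f| / w (deg j)`. -/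
def stepNorm (deg : J → ℕ) (ev : J → V →ₗ[ℂ] ℂ) (w : ℕ → ℝ) :
    Seminorm ℂ (stepSpace deg ev w) :=
  Seminorm.of (fun f => ⨆ j, ‖ev j f‖ / |w (deg j)|)
    (by
      intro f g
      rcases isEmpty_or_nonempty J with hJ | hJ
      · simp
      · refine ciSup_le fun j => ?_
        refine le_trans ?_ (add_le_add (le_ciSup f.2 j) (le_ciSup g.2 j))
        simp only [Submodule.coe_add, map_add, ← add_div]
        gcongr
        exact norm_add_le _ _)
    (by
      intro c f
      simp only [Submodule.coe_smul, map_smul, norm_smul, mul_div_assoc]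
      rw [Real.mul_iSup_of_nonneg (norm_nonneg c)])

/-- The normed space of all vectors of finite weighted norm. -/
def step (deg : J → ℕ) (ev : J → V →ₗ[ℂ] ℂ) (w : ℕ → ℝ) : LCSubspace V :=
  ofSeminorm (stepSpace deg ev w) (stepNorm deg ev w)

/-- Roumieu type `{·}` or Beurling type `(·)`. -/
inductive ClassType
  | roumieu
  | beurling

/-- The weighted space given by a system of weights: the inductive limit of the normed spaces in
the Roumieu case, their projective limit (their intersection) in the Beurling case. -/
def weightedSpace (c : ClassType) (deg : J → ℕ) (ev : J → V →ₗ[ℂ] ℂ) {ι : Type}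
    (w : ι → ℕ → ℝ) : LCSubspace V :=
  match c with
  | .roumieu => indLimit fun i => step deg ev (w i)
  | .beurling => projLimit (fun i => step deg ev (w i)) fun _ => LinearMap.id

/-- The weights `p ↦ h^p M^(ℓ)_p`, `ℓ, h > 0`, which define the spaces `𝔉_[M]` for a matrix
`M = {M^(ℓ) : ℓ > 0}`. -/
def matrixWeights (M : ℝ → ℕ → ℝ) : Ioi (0 : ℝ) × Ioi (0 : ℝ) → ℕ → ℝ :=
  fun i p => (i.2 : ℝ) ^ p * M i.1 p

/-- The weights `p ↦ exp (φ*_ω(ℓ p) / ℓ)`, `ℓ > 0`, which define the spaces `𝔉_[ω]` for a weight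
function `ω`. -/
def functionWeights (ω : ℝ → ℝ) : Ioi (0 : ℝ) → ℕ → ℝ := fun l => assocMatrix ω l

/-! ## Smooth functions -/

/-- Euclidean space `ℝ^d`. -/
abbrev Euc (d : ℕ) : Type := EuclideanSpace ℝ (Fin d)

variable {d : ℕ}

/-- Partial derivative `∂_{i 0} ⋯ ∂_{i (n-1)} f (x)`; the tuples `i` of length `n` give exactly
the partial derivatives `f^(α)(x)` with `|α| = n`. -/
def partialDeriv {n : ℕ} (i : Fin n → Fin d) (f : Euc d → ℂ) (x : Euc d) : ℂ :=
  iteratedFDeriv ℝ n f x fun k => EuclideanSpace.single (i k) 1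

theorem partialDeriv_add {n : ℕ} (i : Fin n → Fin d) {U : Set (Euc d)} (hU : IsOpen U)
    {f g : Euc d → ℂ} (hf : ContDiffOn ℝ (⊤ : ℕ∞) f U) (hg : ContDiffOn ℝ (⊤ : ℕ∞) g U) {x : Euc d}
    (hx : x ∈ U) :
    partialDeriv i (f + g) x = partialDeriv i f x + partialDeriv i g x := by
  have hf' : ContDiffAt ℝ n f x := (hf.contDiffAt (hU.mem_nhds hx)).of_le (by exact_mod_cast le_top)
  have hg' : ContDiffAt ℝ n g x := (hg.contDiffAt (hU.mem_nhds hx)).of_le (by exact_mod_cast le_top)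
  simp only [partialDeriv]
  rw [iteratedFDeriv_add_apply hf' hg']
  rfl

theorem partialDeriv_smul {n : ℕ} (i : Fin n → Fin d) {U : Set (Euc d)} (hU : IsOpen U)
    (c : ℂ) {f : Euc d → ℂ} (hf : ContDiffOn ℝ (⊤ : ℕ∞) f U) {x : Euc d} (hx : x ∈ U) :
    partialDeriv i (c • f) x = c * partialDeriv i f x := by
  have hf' : ContDiffAt ℝ n f x := (hf.contDiffAt (hU.mem_nhds hx)).of_le (by exact_mod_cast le_top)
  simp only [partialDeriv]
  rw [iteratedFDeriv_const_smul_apply hf']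
  rfl

/-- Smooth functions on the open set `U`, extended by zero. -/
def smoothFun (U : TopologicalSpace.Opens (Euc d)) : Submodule ℂ (Euc d → ℂ) where
  carrier := {f | ContDiffOn ℝ (⊤ : ℕ∞) f U ∧ ∀ x ∉ U, f x = 0}
  zero_mem' := ⟨contDiffOn_const, fun _ _ => rfl⟩
  add_mem' := fun hf hg => ⟨hf.1.add hg.1, fun x hx => by simp [hf.2 x hx, hg.2 x hx]⟩
  smul_mem' := fun c f hf => ⟨hf.1.const_smul c, fun x hx => by simp [hf.2 x hx]⟩

/-- The index set of all partial derivatives at points of `U`. -/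
abbrev DerivIndex (U : TopologicalSpace.Opens (Euc d)) : Type := U × Σ n : ℕ, (Fin n → Fin d)

/-- The order of a partial derivative. -/
def derivDeg {U : TopologicalSpace.Opens (Euc d)} (j : DerivIndex U) : ℕ := j.2.1

/-- Partial derivatives at points of `U` as linear functionals. -/
def derivEv (U : TopologicalSpace.Opens (Euc d)) (j : DerivIndex U) : smoothFun U →ₗ[ℂ] ℂ where
  toFun f := partialDeriv j.2.2 f j.1
  map_add' f g := partialDeriv_add j.2.2 U.isOpen f.2.1 g.2.1 j.1.2
  map_smul' c f := partialDeriv_smul j.2.2 U.isOpen c f.2.1 j.1.2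

/-- The interior of a set as an open set. -/
abbrev interiorOpens (K : Set (Euc d)) : TopologicalSpace.Opens (Euc d) :=
  ⟨interior K, isOpen_interior⟩

/-- The space `C^∞(K)` for a compact set `K` which is the closure of its interior: smooth functions
in the interior of `K` all of whose partial derivatives extend continuously to `K`. -/
def smoothFunCompact (K : Set (Euc d)) : Submodule ℂ (smoothFun (interiorOpens K)) where
  carrier := {f | ∀ (n : ℕ) (i : Fin n → Fin d),
    ∃ g : Euc d → ℂ, ContinuousOn g K ∧ EqOn g (partialDeriv i f) (interior K)}
  zero_mem' := fun n i => ⟨0, continuousOn_const, fun x hx => by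
    simp [partialDeriv]⟩
  add_mem' := fun {f g} hf hg n i => by
    obtain ⟨u, hu, hu'⟩ := hf n i
    obtain ⟨v, hv, hv'⟩ := hg n i
    refine ⟨u + v, hu.add hv, fun x hx => ?_⟩
    have h := partialDeriv_add i isOpen_interior f.2.1 g.2.1 hx
    rw [Submodule.coe_add, h, Pi.add_apply, hu' hx, hv' hx]
  smul_mem' := fun c f hf n i => by
    obtain ⟨u, hu, hu'⟩ := hf n i
    refine ⟨c • u, hu.const_smul c, fun x hx => ?_⟩
    have h := partialDeriv_smul i isOpen_interior c f.2.1 hx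
    rw [Submodule.coe_smul, h, Pi.smul_apply, hu' hx, smul_eq_mul]

/-- The compact subsets of `U` that are the closure of their interior. -/
abbrev RegularCompact (U : TopologicalSpace.Opens (Euc d)) : Type :=
  {K : Set (Euc d) // IsCompact K ∧ closure (interior K) = K ∧ K ⊆ U}

theorem partialDeriv_indicator {n : ℕ} (i : Fin n → Fin d) (K : Set (Euc d)) (f : Euc d → ℂ)
    {x : Euc d} (hx : x ∈ interior K) :
    partialDeriv i ((interior K).indicator f) x = partialDeriv i f x := by
  have h : (interior K).indicator f =ᶠ[𝓝 x] f := by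
    filter_upwards [isOpen_interior.mem_nhds hx] with y hy
    exact indicator_of_mem hy f
  simp only [partialDeriv]
  rw [(h.iteratedFDeriv ℝ n).eq_of_nhds]

/-- Restriction of functions on `U` to `K ⊆ U`. -/
def restrictCompact (U : TopologicalSpace.Opens (Euc d)) (K : RegularCompact U) :
    smoothFun U →ₗ[ℂ] smoothFunCompact K.1 where
  toFun f := ⟨⟨(interior K.1).indicator f,
      (f.2.1.mono (interior_subset.trans K.2.2.2)).congr fun x hx => indicator_of_mem hx _,
      fun x hx => indicator_of_notMem hx _⟩, fun n i => by
    refine ⟨partialDeriv i f, ?_, fun x hx => (partialDeriv_indicator i K.1 f hx).symm⟩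
    intro x hx
    have hxU : x ∈ (U : Set (Euc d)) := K.2.2.2 hx
    have h : ContDiffAt ℝ (⊤ : ℕ∞) (f : Euc d → ℂ) x := f.2.1.contDiffAt (U.isOpen.mem_nhds hxU)
    have h' : ContinuousAt (iteratedFDeriv ℝ n (f : Euc d → ℂ)) x :=
      (h.iteratedFDeriv_right (m := 0) (i := n)
        (by rw [zero_add]; exact_mod_cast le_top)).continuousAt
    have h2 : ContinuousAt (fun y => partialDeriv i (f : Euc d → ℂ) y) x :=
      ((ContinuousMultilinearMap.apply ℝ (fun _ : Fin n => Euc d) ℂ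
        (fun k => EuclideanSpace.single (i k) 1)).continuous.continuousAt).comp h'
    exact h2.continuousWithinAt⟩
  map_add' f g := by
    ext x
    by_cases hx : x ∈ interior K.1 <;> simp [hx]
  map_smul' c f := by
    ext x
    by_cases hx : x ∈ interior K.1 <;> simp [hx]

/-- Index set for the Gelfand-Shilov norms: an exponent of `1 + |x|`, a point and a partial
derivative. -/
abbrev GelfandShilovIndex (d : ℕ) : Type := ℕ × DerivIndex (⊤ : TopologicalSpace.Opens (Euc d))

/-- The functional `f ↦ (1 + |x|)^k f^(α)(x)`. -/
def gelfandShilovEv (j : GelfandShilovIndex d) :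
    smoothFun (⊤ : TopologicalSpace.Opens (Euc d)) →ₗ[ℂ] ℂ :=
  (((1 + ‖(j.2.1 : Euc d)‖) ^ j.1 : ℝ) : ℂ) • derivEv ⊤ j.2

/-! ## Holomorphic functions on the Riemann surface of the logarithm -/

/-- Derivative with respect to `z` in the coordinate `w = log z` on the Riemann surface of the
logarithm: `d/dz = e^{-w} d/dw`. -/
def zDeriv (g : ℂ → ℂ) (w : ℂ) : ℂ := Complex.exp (-w) * deriv g w

theorem differentiableOn_zDeriv {G : Set ℂ} (hG : IsOpen G) {g : ℂ → ℂ}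
    (hg : DifferentiableOn ℂ g G) (p : ℕ) : DifferentiableOn ℂ (zDeriv^[p] g) G := by
  induction p with
  | zero => exact hg
  | succ p ih =>
    rw [Function.iterate_succ_apply']
    exact (by fun_prop : DifferentiableOn ℂ (fun w => Complex.exp (-w)) G).mul (ih.deriv hG)

theorem zDeriv_add {G : Set ℂ} (hG : IsOpen G) {f g : ℂ → ℂ} (hf : DifferentiableOn ℂ f G)
    (hg : DifferentiableOn ℂ g G) (p : ℕ) :
    EqOn (zDeriv^[p] (f + g)) (zDeriv^[p] f + zDeriv^[p] g) G := by
  induction p with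
  | zero => exact fun _ _ => rfl
  | succ p ih =>
    intro w hw
    have h := (ih.eventuallyEq_of_mem (hG.mem_nhds hw)).deriv_eq
    have hf' := (differentiableOn_zDeriv hG hf p).differentiableAt (hG.mem_nhds hw)
    have hg' := (differentiableOn_zDeriv hG hg p).differentiableAt (hG.mem_nhds hw)
    rw [deriv_add hf' hg'] at h
    simp only [Function.iterate_succ_apply', Pi.add_apply, zDeriv, h]
    ring

theorem zDeriv_smul {G : Set ℂ} (hG : IsOpen G) (c : ℂ) {f : ℂ → ℂ}
    (hf : DifferentiableOn ℂ f G) (p : ℕ) :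
    EqOn (zDeriv^[p] (c • f)) (c • zDeriv^[p] f) G := by
  induction p with
  | zero => exact fun _ _ => rfl
  | succ p ih =>
    intro w hw
    have h := (ih.eventuallyEq_of_mem (hG.mem_nhds hw)).deriv_eq
    have hf' := (differentiableOn_zDeriv hG hf p).differentiableAt (hG.mem_nhds hw)
    rw [deriv_const_smul c hf'] at h
    simp only [Function.iterate_succ_apply', Pi.smul_apply, zDeriv, h, smul_eq_mul]
    ring

/-- Holomorphic functions on an open subset of the Riemann surface of the logarithm, in the
coordinate `w = log z` and extended by zero. The (unbounded) sectors `a < arg z < b` are the sets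
`{w | a < Im w < b}`. -/
def holoFun (G : TopologicalSpace.Opens ℂ) : Submodule ℂ (ℂ → ℂ) where
  carrier := {f | DifferentiableOn ℂ f G ∧ ∀ w ∉ G, f w = 0}
  zero_mem' := ⟨differentiableOn_const _, fun _ _ => rfl⟩
  add_mem' := fun hf hg => ⟨hf.1.add hg.1, fun x hx => by simp [hf.2 x hx, hg.2 x hx]⟩
  smul_mem' := fun c f hf => ⟨hf.1.const_smul c, fun x hx => by simp [hf.2 x hx]⟩

/-- The functionals `f ↦ f^(p)(z)`, `z ∈ G`, `p ∈ ℕ`. -/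
def holoEv (G : TopologicalSpace.Opens ℂ) (j : G × ℕ) : holoFun G →ₗ[ℂ] ℂ where
  toFun f := zDeriv^[j.2] f j.1
  map_add' f g := zDeriv_add G.isOpen f.2.1 g.2.1 j.2 j.1.2
  map_smul' c f := zDeriv_smul G.isOpen c f.2.1 j.2 j.1.2

/-! ## The weighted spaces -/

/-- The settings `𝓔, 𝓑, 𝓐, 𝓢, Λ, 𝓕`, with their underlying domains. -/
inductive Setting
  /-- local classes of ultradifferentiable functions on an open set of `ℝ^d` -/
  | localClass (d : ℕ) (U : TopologicalSpace.Opens (Euc d))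
  /-- global classes of ultradifferentiable functions on an open set of `ℝ^d` -/
  | globalClass (d : ℕ) (U : TopologicalSpace.Opens (Euc d))
  /-- ultraholomorphic functions on an open set (such as a sector) of the Riemann surface of the
  logarithm -/
  | ultraholomorphic (G : TopologicalSpace.Opens ℂ)
  /-- spaces of Gelfand-Shilov type on `ℝ^d` -/
  | gelfandShilov (d : ℕ)
  /-- sequences of complex numbers -/
  | sequences
  /-- formal power series `∑ a_p x^p`, normed by the sizes of the numbers `a_p` -/
  | powerSeries
  /-- formal power series `∑ (a_p / p!) x^p`, normed by the sizes of the numbers `a_p` -/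
  | taylorSeries

/-- The vector space in which all weighted spaces of a setting lie. -/
def Setting.Ambient : Setting → Type
  | .localClass _ U => smoothFun U
  | .globalClass _ U => smoothFun U
  | .ultraholomorphic G => holoFun G
  | .gelfandShilov d => smoothFun (⊤ : TopologicalSpace.Opens (Euc d))
  | .sequences => ℕ → ℂ
  | .powerSeries => PowerSeries ℂ
  | .taylorSeries => PowerSeries ℂ

instance : ∀ F : Setting, AddCommGroup F.Ambient
  | .localClass _ U => inferInstanceAs (AddCommGroup (smoothFun U))
  | .globalClass _ U => inferInstanceAs (AddCommGroup (smoothFun U))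
  | .ultraholomorphic G => inferInstanceAs (AddCommGroup (holoFun G))
  | .gelfandShilov d =>
    inferInstanceAs (AddCommGroup (smoothFun (⊤ : TopologicalSpace.Opens (Euc d))))
  | .sequences => inferInstanceAs (AddCommGroup (ℕ → ℂ))
  | .powerSeries => inferInstanceAs (AddCommGroup (PowerSeries ℂ))
  | .taylorSeries => inferInstanceAs (AddCommGroup (PowerSeries ℂ))

instance : ∀ F : Setting, Module ℂ F.Ambient
  | .localClass _ U => inferInstanceAs (Module ℂ (smoothFun U))
  | .globalClass _ U => inferInstanceAs (Module ℂ (smoothFun U))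
  | .ultraholomorphic G => inferInstanceAs (Module ℂ (holoFun G))
  | .gelfandShilov d =>
    inferInstanceAs (Module ℂ (smoothFun (⊤ : TopologicalSpace.Opens (Euc d))))
  | .sequences => inferInstanceAs (Module ℂ (ℕ → ℂ))
  | .powerSeries => inferInstanceAs (Module ℂ (PowerSeries ℂ))
  | .taylorSeries => inferInstanceAs (Module ℂ (PowerSeries ℂ))

/-- The weighted space `𝔉_{·}` or `𝔉_(·)` given by a system of weights. The local class is the
projective limit, over the compact subsets `K` of `U` that are the closure of their interior, of
the weighted spaces of smooth functions on `K`. -/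
def Setting.space (c : ClassType) {ι : Type} (w : ι → ℕ → ℝ) : ∀ F : Setting, LCSubspace F.Ambient
  | .localClass _ U =>
    projLimit (V := smoothFun U) (V' := fun K : RegularCompact U => smoothFunCompact K.1)
      (fun K => weightedSpace c derivDeg
        (fun j => (derivEv (interiorOpens K.1) j).comp (smoothFunCompact K.1).subtype) w)
      (restrictCompact U)
  | .globalClass _ U => weightedSpace (V := smoothFun U) c derivDeg (derivEv U) w
  | .ultraholomorphic G => weightedSpace (V := holoFun G) c Prod.snd (holoEv G) w
  | .gelfandShilov d =>
    weightedSpace (V := smoothFun (⊤ : TopologicalSpace.Opens (Euc d))) c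
      (fun j : GelfandShilovIndex d => derivDeg j.2 + j.1) gelfandShilovEv w
  | .sequences =>
    weightedSpace (V := ℕ → ℂ) c (fun p : ℕ => p) (fun p => LinearMap.proj p) w
  | .powerSeries =>
    weightedSpace (V := PowerSeries ℂ) c (fun p : ℕ => p) (fun p => PowerSeries.coeff p) w
  | .taylorSeries =>
    weightedSpace (V := PowerSeries ℂ) c (fun p : ℕ => p)
      (fun p => (Nat.factorial p : ℂ) • PowerSeries.coeff p) w

/-- The space `𝔉_[M]` for a matrix `M = {M^(ℓ) : ℓ > 0}` of sequences. -/
def Setting.ofMatrix (F : Setting) (c : ClassType) (M : ℝ → ℕ → ℝ) : LCSubspace F.Ambient :=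
  F.space c (matrixWeights M)

/-- The space `𝔉_[ω]` for a weight function `ω`. -/
def Setting.ofFunction (F : Setting) (c : ClassType) (ω : ℝ → ℝ) : LCSubspace F.Ambient :=
  F.space c (functionWeights ω)

end

end UpperLegendre

open UpperLegendre

/-! Write ω for the upper conjugate of σ and τ, and φ* for Young conjugates. Every space here
depends monotonically on its weights, so equality as locally convex spaces reduces to mutual
domination of weight systems up to constants: `WeightsLE` has one quantifier pattern per limit type,
and `Setting.space_eq` turns it into an equality. What remains concerns only sequences.

The gap between the indices gives exponents a < b with σ(rt) ≤ C r^a (σ(t) + 1) and c r^b τ(t) ≤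
τ(rt) + 1 for r ≥ 1. A large common dilation therefore enlarges τ by a bigger factor than σ, which
is `DilationDominated`. This has three consequences. Since σ ≤ τ + const, the conjugate is finite at
every t. It satisfies ω(kt) ≤ Lω(t) + D, so geometric factors h^p cost only a change of ℓ
(`pow_mul_assocMatrix_le`). Finally, replacing σ, τ by their associated functions, which agree with
them up to factors and constants (`IsBMTWeight.assocFun_le`, `IsBMTWeight.le_assocFun`), changes ω
only up to the same kind of comparison.

It remains to compare S^(ℓ)/T^(ℓ) with the matrix of ω. The definition of ω gives φ*_ω ≤ φ*_σ − φ*_τ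
directly (`IsBMTWeight.add_youngConj_le`). The converse, `youngConj_sub_le`, bounds φ*_σ(x) −
φ*_τ(x) by φ*_ω(2x)/2 plus an affine function of x. Its linear term becomes a geometric factor,
which the dilation estimate absorbs. -/

namespace UpperLegendre

/-! ## Comparison of locally convex subspaces -/

namespace LCSubspace

variable {V : Type*} [AddCommGroup V] [Module ℂ V]

/-- Continuous inclusion of locally convex subspaces. -/
def Embeds (X Y : LCSubspace V) : Prop :=
  ∃ h : X.carrier ≤ Y.carrier, @Continuous _ _ X.top Y.top (Submodule.inclusion h)

theorem Embeds.trans {X Y Z : LCSubspace V} (h₁ : X.Embeds Y) (h₂ : Y.Embeds Z) : X.Embeds Z := by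
  obtain ⟨h₁, c₁⟩ := h₁
  obtain ⟨h₂, c₂⟩ := h₂
  let := X.top
  let := Y.top
  let := Z.top
  exact ⟨h₁.trans h₂, c₂.comp c₁⟩

theorem Embeds.antisymm {X Y : LCSubspace V} (h₁ : X.Embeds Y) (h₂ : Y.Embeds X) : X = Y := by
  obtain ⟨W, t, _, _, _⟩ := X
  obtain ⟨W', t', _, _, _⟩ := Y
  obtain ⟨h₁, c₁⟩ := h₁
  obtain ⟨h₂, c₂⟩ := h₂
  obtain rfl : W = W' := le_antisymm h₁ h₂
  obtain rfl : t = t' := by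
    apply le_antisymm
    · exact continuous_id_iff_le.1 c₁
    · exact continuous_id_iff_le.1 c₂
  rfl

theorem embeds_indLimit {ι : Type*} (X : ι → LCSubspace V) (i : ι) : (X i).Embeds (indLimit X) :=
  ⟨le_iSup (fun i => (X i).carrier) i, by
    let := (X i).top
    exact continuous_sInf_rng.2 fun t ht => ht.2 i⟩

/-- The topology induced from Y is locally convex and makes all inclusions of the steps continuous.
It is thus one of the topologies whose infimum defines the inductive limit, hence coarser than the
limit topology. -/
theorem indLimit_embeds {ι : Type*} {X : ι → LCSubspace V} {Y : LCSubspace V}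
    (h : ∀ i, (X i).Embeds Y) : (indLimit X).Embeds Y := by
  have hle : (indLimit X).carrier ≤ Y.carrier := iSup_le fun i => (h i).1
  refine ⟨hle, ?_⟩
  let := Y.top
  have := Y.addGroup
  have := Y.smul
  have := Y.locallyConvex
  refine continuous_iff_le_induced.2 (sInf_le ⟨⟨?_, ?_, ?_⟩, fun i => ?_⟩)
  · exact topologicalAddGroup_induced (Submodule.inclusion hle)
  · exact continuousSMul_induced (Submodule.inclusion hle)
  · exact LocallyConvexSpace.induced ((Submodule.inclusion hle).restrictScalars ℝ)
  · let := (X i).top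
    exact continuous_induced_rng.2 (h i).2

variable {κ : Type*} {V' : κ → Type*} [∀ k, AddCommGroup (V' k)] [∀ k, Module ℂ (V' k)]

theorem embeds_projLimit {Z : LCSubspace V} {X : ∀ k, LCSubspace (V' k)} {ρ : ∀ k, V →ₗ[ℂ] V' k}
    (h : ∀ k, ∃ hk : ∀ f ∈ Z.carrier, ρ k f ∈ (X k).carrier,
      @Continuous _ _ Z.top (X k).top ((ρ k).restrict hk)) : Z.Embeds (projLimit X ρ) := by
  refine ⟨le_iInf fun k => (h k).1, ?_⟩
  let := Z.top
  refine continuous_iInf_rng.2 fun k => ?_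
  let := (X k).top
  exact continuous_induced_rng.2 (h k).2

theorem projLimit_restrict_continuous (X : ∀ k, LCSubspace (V' k)) (ρ : ∀ k, V →ₗ[ℂ] V' k) (k : κ) :
    ∃ hk : ∀ f ∈ (projLimit X ρ).carrier, ρ k f ∈ (X k).carrier,
      @Continuous _ _ (projLimit X ρ).top (X k).top ((ρ k).restrict hk) := by
  refine ⟨fun f hf => (Submodule.mem_iInf _).1 hf k, ?_⟩
  let := (X k).top
  exact continuous_iInf_dom (i := k) continuous_induced_dom

theorem projLimit_embeds_projLimit {X Y : ∀ k, LCSubspace (V' k)} {ρ : ∀ k, V →ₗ[ℂ] V' k}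
    (h : ∀ k, (X k).Embeds (Y k)) : (projLimit X ρ).Embeds (projLimit Y ρ) := by
  refine embeds_projLimit fun k => ?_
  obtain ⟨hk, ck⟩ := projLimit_restrict_continuous X ρ k
  obtain ⟨h, c⟩ := h k
  refine ⟨fun f hf => h (hk f hf), ?_⟩
  let := (projLimit X ρ).top
  let := (X k).top
  let := (Y k).top
  exact c.comp ck

theorem projLimit_id_embeds {X : κ → LCSubspace V} (k : κ) :
    (projLimit X fun _ => LinearMap.id).Embeds (X k) :=
  projLimit_restrict_continuous X (fun _ => LinearMap.id) k

theorem embeds_projLimit_id {Z : LCSubspace V} {X : κ → LCSubspace V}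
    (h : ∀ k, Z.Embeds (X k)) : Z.Embeds (projLimit X fun _ => LinearMap.id) :=
  embeds_projLimit h

end LCSubspace

/-! ## Comparison of weight systems -/

/-- The weights `w` are dominated by the weights `v`, in the Roumieu and in the Beurling sense. -/
def WeightsLE {ι κ : Type} (w : ι → ℕ → ℝ) (v : κ → ℕ → ℝ) : Prop :=
  (∀ i, ∃ j, ∃ C : ℝ, ∀ p, w i p ≤ C * v j p) ∧ ∀ j, ∃ i, ∃ C : ℝ, ∀ p, w i p ≤ C * v j p

section

variable {V : Type*} [AddCommGroup V] [Module ℂ V] {J : Type*}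

theorem step_embeds (deg : J → ℕ) (ev : J → V →ₗ[ℂ] ℂ) {w v : ℕ → ℝ} (hw : ∀ p, 0 < w p)
    (hv : ∀ p, 0 < v p) {C : ℝ} (h : ∀ p, w p ≤ C * v p) :
    (step deg ev w).Embeds (step deg ev v) := by
  have hC : 0 < C := pos_of_mul_pos_left ((hw 0).trans_le (h 0)) (hv 0).le
  have key : ∀ (f : V) (j : J), ‖ev j f‖ / |v (deg j)| ≤ C * (‖ev j f‖ / |w (deg j)|) := by
    intro f j
    rw [abs_of_pos (hw _), abs_of_pos (hv _), ← mul_div_assoc, div_le_div_iff₀ (hv _) (hw _)]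
    nlinarith [mul_le_mul_of_nonneg_left (h (deg j)) (norm_nonneg (ev j f))]
  have hle : stepSpace deg ev w ≤ stepSpace deg ev v := by
    rintro f ⟨a, ha⟩
    refine ⟨C * a, ?_⟩
    rintro _ ⟨j, rfl⟩
    exact (key f j).trans (mul_le_mul_of_nonneg_left (ha ⟨j, rfl⟩) hC.le)
  refine ⟨hle, ?_⟩
  let : TopologicalSpace (stepSpace deg ev w) := (step deg ev w).top
  let : TopologicalSpace (stepSpace deg ev v) := (step deg ev v).top
  have := (step deg ev w).addGroup
  have := (step deg ev v).addGroup
  have hW : WithSeminorms (𝕜 := ℂ) (E := stepSpace deg ev w) (fun _ : Unit => stepNorm deg ev w) :=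
    ⟨rfl⟩
  have hV : WithSeminorms (𝕜 := ℂ) (E := stepSpace deg ev v) (fun _ : Unit => stepNorm deg ev v) :=
    ⟨rfl⟩
  refine WithSeminorms.continuous_of_isBounded hW hV (Submodule.inclusion hle)
    (Seminorm.IsBounded.of_real fun _ => ⟨{()}, C, fun f => ?_⟩)
  simp only [Finset.sup_singleton]
  show (⨆ j, ‖ev j f‖ / |v (deg j)|) ≤ C * ⨆ j, ‖ev j f‖ / |w (deg j)|
  rw [Real.mul_iSup_of_nonneg hC.le]
  -- Over an empty index set both real suprema take the default value 0.
  rcases isEmpty_or_nonempty J with hJ | hJ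
  · simp
  · obtain ⟨a, ha⟩ := f.2
    refine ciSup_mono ⟨C * a, ?_⟩ (key f)
    rintro _ ⟨j, rfl⟩
    exact mul_le_mul_of_nonneg_left (ha ⟨j, rfl⟩) hC.le

theorem weightedSpace_embeds (c : ClassType) (deg : J → ℕ) (ev : J → V →ₗ[ℂ] ℂ) {ι κ : Type}
    {w : ι → ℕ → ℝ} {v : κ → ℕ → ℝ} (hw : ∀ i p, 0 < w i p) (hv : ∀ j p, 0 < v j p)
    (h : WeightsLE w v) : (weightedSpace c deg ev w).Embeds (weightedSpace c deg ev v) := by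
  cases c with
  | roumieu =>
    refine LCSubspace.indLimit_embeds fun i => ?_
    obtain ⟨j, C, hj⟩ := h.1 i
    exact (step_embeds deg ev (hw i) (hv j) hj).trans
      (LCSubspace.embeds_indLimit (fun j => step deg ev (v j)) j)
  | beurling =>
    refine LCSubspace.embeds_projLimit_id fun j => ?_
    obtain ⟨i, C, hi⟩ := h.2 j
    exact (LCSubspace.projLimit_id_embeds i).trans (step_embeds deg ev (hw i) (hv j) hi)

end

theorem Setting.space_embeds (F : Setting) (c : ClassType) {ι κ : Type}
    {w : ι → ℕ → ℝ} {v : κ → ℕ → ℝ} (hw : ∀ i p, 0 < w i p) (hv : ∀ j p, 0 < v j p)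
    (h : WeightsLE w v) : (F.space c w).Embeds (F.space c v) := by
  cases F with
  | localClass d U =>
    exact LCSubspace.projLimit_embeds_projLimit fun K => weightedSpace_embeds c _ _ hw hv h
  | globalClass d U => exact weightedSpace_embeds (V := smoothFun U) c _ _ hw hv h
  | ultraholomorphic G => exact weightedSpace_embeds (V := holoFun G) c _ _ hw hv h
  | gelfandShilov d =>
    exact weightedSpace_embeds (V := smoothFun (⊤ : TopologicalSpace.Opens (Euc d))) c _ _ hw hv h
  | sequences => exact weightedSpace_embeds (V := ℕ → ℂ) c _ _ hw hv h
  | powerSeries => exact weightedSpace_embeds (V := PowerSeries ℂ) c _ _ hw hv h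
  | taylorSeries => exact weightedSpace_embeds (V := PowerSeries ℂ) c _ _ hw hv h

theorem Setting.space_eq (F : Setting) (c : ClassType) {ι κ : Type}
    {w : ι → ℕ → ℝ} {v : κ → ℕ → ℝ} (hw : ∀ i p, 0 < w i p) (hv : ∀ j p, 0 < v j p)
    (h₁ : WeightsLE w v) (h₂ : WeightsLE v w) : F.space c w = F.space c v :=
  (F.space_embeds c hw hv h₁).antisymm (F.space_embeds c hv hw h₂)

/-! ## Growth estimates from the indices -/

/-- Iterating σ(K^γ t) ≤ Kσ(t) beyond a threshold T gives K^n for the dilation K^(γn). Squeezing r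
between consecutive powers of K^γ turns K^n into r^(1/γ). The summand 1 on the right covers t < T,
where σ may vanish. -/
theorem growth_upper {σ : ℝ → ℝ} (hσ : IsWeightFunction σ) {γ : ℝ} (hγ : 0 < γ) (h : PropP σ γ) :
    ∃ C : ℝ, 0 < C ∧ ∀ r t : ℝ, 1 ≤ r → 0 ≤ t → σ (r * t) ≤ C * r ^ (1 / γ) * (σ t + 1) := by
  obtain ⟨K, hK, hlim⟩ := h
  have hK0 : 0 < K := by linarith
  have hev := (eventually_lt_of_limsup_lt hlim).and
    ((hσ.tendsto.eventually_gt_atTop 0).and (eventually_ge_atTop (0 : ℝ)))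
  obtain ⟨T, hT⟩ := eventually_atTop.1 hev
  have hT0 : 0 ≤ T := (hT T le_rfl).2.2
  set B : ℝ := K ^ γ with hB
  have hB1 : 1 < B := Real.one_lt_rpow hK hγ
  have hstep : ∀ t, T ≤ t → σ (B * t) ≤ K * σ t := fun t ht => by
    obtain ⟨h1, h2, -⟩ := hT t ht
    exact ((div_lt_iff₀ h2).1 (by exact_mod_cast h1)).le
  have hpow : ∀ (n : ℕ) (t : ℝ), T ≤ t → σ (B ^ n * t) ≤ K ^ n * σ t := by
    intro n
    induction n with
    | zero => simp
    | succ n ih =>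
      intro t ht
      have h1 : T ≤ B ^ n * t :=
        ht.trans (le_mul_of_one_le_left (hT0.trans ht) (one_le_pow₀ hB1.le))
      calc σ (B ^ (n + 1) * t) = σ (B * (B ^ n * t)) := by ring_nf
        _ ≤ K * σ (B ^ n * t) := hstep _ h1
        _ ≤ K * (K ^ n * σ t) := by gcongr; exact ih t ht
        _ = K ^ (n + 1) * σ t := by ring
  have hσT : 0 ≤ σ T := hσ.nonneg T hT0
  refine ⟨K * (1 + σ T), by positivity, fun r t hr ht => ?_⟩
  obtain ⟨n, hn, hn'⟩ := exists_nat_pow_near hr hB1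
  have hKn : K ^ n ≤ r ^ (1 / γ) := by
    calc K ^ n = (B ^ n) ^ (1 / γ) := by
          rw [hB, ← Real.rpow_natCast, ← Real.rpow_natCast, ← Real.rpow_mul hK0.le,
            ← Real.rpow_mul hK0.le]
          congr 1
          field_simp
      _ ≤ r ^ (1 / γ) := Real.rpow_le_rpow (by positivity) hn (by positivity)
  have ht' : 0 ≤ max t T := le_max_of_le_left ht
  have hmax : σ (max t T) ≤ (1 + σ T) * (σ t + 1) := by
    have := hσ.nonneg t ht
    rcases max_cases t T with ⟨h, -⟩ | ⟨h, -⟩ <;> rw [h] <;> nlinarith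
  calc σ (r * t) ≤ σ (B ^ (n + 1) * max t T) :=
        hσ.monotoneOn (mem_Ici.2 (by positivity)) (mem_Ici.2 (by positivity))
          (mul_le_mul hn'.le (le_max_left _ _) ht (by positivity))
    _ ≤ K ^ (n + 1) * σ (max t T) := hpow _ _ (le_max_right _ _)
    _ ≤ K ^ (n + 1) * ((1 + σ T) * (σ t + 1)) := by gcongr
    _ = K * (1 + σ T) * K ^ n * (σ t + 1) := by ring
    _ ≤ K * (1 + σ T) * r ^ (1 / γ) * (σ t + 1) := by
        have := hσ.nonneg t ht
        gcongr

/-- The same iteration settles t ≥ T. Below T, what helps is that τ vanishes on [0, 1], so only 1 ≤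
t ≤ T needs an argument. -/
theorem growth_lower {τ : ℝ → ℝ} (hτ : IsBMTWeight τ) {γ : ℝ} (hγ : 0 < γ) (h : PropPbar τ γ) :
    ∃ c : ℝ, 0 < c ∧ ∀ r t : ℝ, 1 ≤ r → 0 ≤ t → c * r ^ (1 / γ) * τ t ≤ τ (r * t) + 1 := by
  obtain ⟨A, hA, hlim⟩ := h
  have hA0 : 0 < A := by linarith
  have hev := (eventually_lt_of_lt_liminf hlim).and
    ((hτ.tendsto.eventually_gt_atTop 0).and (eventually_ge_atTop (1 : ℝ)))
  obtain ⟨T, hT⟩ := eventually_atTop.1 hev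
  have hT1 : 1 ≤ T := (hT T le_rfl).2.2
  have hT0 : 0 < T := by linarith
  set B : ℝ := A ^ γ with hB
  have hB1 : 1 < B := Real.one_lt_rpow hA hγ
  have hstep : ∀ t, T ≤ t → A * τ t ≤ τ (B * t) := fun t ht => by
    obtain ⟨h1, h2, -⟩ := hT t ht
    exact ((lt_div_iff₀ h2).1 (by exact_mod_cast h1)).le
  have hpow : ∀ (n : ℕ) (t : ℝ), T ≤ t → A ^ n * τ t ≤ τ (B ^ n * t) := by
    intro n
    induction n with
    | zero => simp
    | succ n ih =>
      intro t ht
      have h1 : T ≤ B ^ n * t :=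
        ht.trans (le_mul_of_one_le_left (hT0.le.trans ht) (one_le_pow₀ hB1.le))
      calc A ^ (n + 1) * τ t = A * (A ^ n * τ t) := by ring
        _ ≤ A * τ (B ^ n * t) := by gcongr; exact ih t ht
        _ ≤ τ (B * (B ^ n * t)) := hstep _ h1
        _ = τ (B ^ (n + 1) * t) := by ring_nf
  have hlarge : ∀ r t : ℝ, 1 ≤ r → T ≤ t → r ^ (1 / γ) * τ t ≤ A * τ (r * t) := by
    intro r t hr ht
    have ht0 : 0 ≤ t := hT0.le.trans ht
    obtain ⟨n, hn, hn'⟩ := exists_nat_pow_near hr hB1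
    have hAn : r ^ (1 / γ) ≤ A ^ (n + 1) := by
      calc r ^ (1 / γ) ≤ (B ^ (n + 1)) ^ (1 / γ) :=
            Real.rpow_le_rpow (by positivity) hn'.le (by positivity)
        _ = A ^ (n + 1) := by
          rw [hB, ← Real.rpow_natCast, ← Real.rpow_natCast, ← Real.rpow_mul hA0.le,
            ← Real.rpow_mul hA0.le]
          congr 1
          field_simp
    calc r ^ (1 / γ) * τ t ≤ A ^ (n + 1) * τ t :=
          mul_le_mul_of_nonneg_right hAn (hτ.nonneg t ht0)
      _ = A * (A ^ n * τ t) := by ring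
      _ ≤ A * τ (B ^ n * t) := by gcongr; exact hpow n t ht
      _ ≤ A * τ (r * t) := by
          gcongr
          exact hτ.monotoneOn (mem_Ici.2 (by positivity)) (mem_Ici.2 (by positivity)) (by gcongr)
  have hτT : 0 ≤ τ T := hτ.nonneg T hT0.le
  have hTb : 1 ≤ T ^ (1 / γ) := Real.one_le_rpow hT1 (by positivity)
  set N : ℝ := A * T ^ (1 / γ) * (1 + τ T) with hN
  have hN0 : 0 < N := by positivity
  refine ⟨1 / N, by positivity, fun r t hr ht => ?_⟩
  have hrt : 0 ≤ r * t := by positivity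
  have hτrt : 0 ≤ τ (r * t) := hτ.nonneg _ hrt
  have hτt : 0 ≤ τ t := hτ.nonneg _ ht
  have hANT : A * T ^ (1 / γ) ≤ N := le_mul_of_one_le_right (by positivity) (by linarith)
  have hAN : A ≤ N := (le_mul_of_one_le_right hA0.le hTb).trans hANT
  rw [mul_assoc, one_div_mul_eq_div, div_le_iff₀ hN0]
  rcases le_total T t with hTt | hTt
  · nlinarith [hlarge r t hr hTt]
  rcases le_total t 1 with ht1 | ht1
  · rw [hτ.eq_zero t ⟨ht, ht1⟩]
    simp only [mul_zero]
    positivity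
  have hτtT : τ t ≤ τ T := hτ.monotoneOn (mem_Ici.2 ht) (mem_Ici.2 hT0.le) hTt
  -- For r ≤ T the left side is bounded and the summand 1 suffices. For r ≥ T the estimate is
  -- applied at the base point T with factor r/T, and τ(r) ≤ τ(rt) because t ≥ 1.
  rcases le_total r T with hrT | hrT
  · calc r ^ (1 / γ) * τ t ≤ T ^ (1 / γ) * (1 + τ T) := by
          gcongr
          linarith
      _ ≤ N := by rw [hN, mul_assoc]; exact le_mul_of_one_le_left (by positivity) hA.le
      _ ≤ (τ (r * t) + 1) * N := by nlinarith
  · have h1 := hlarge (r / T) T ((one_le_div hT0).2 hrT) le_rfl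
    rw [Real.div_rpow (by positivity) hT0.le, div_mul_cancel₀ _ hT0.ne', div_mul_eq_mul_div,
      div_le_iff₀ (by positivity)] at h1
    have h2 : τ r ≤ τ (r * t) := hτ.monotoneOn (mem_Ici.2 (by positivity)) (mem_Ici.2 hrt)
      (le_mul_of_one_le_right (by positivity) ht1)
    calc r ^ (1 / γ) * τ t ≤ r ^ (1 / γ) * τ T := by gcongr
      _ ≤ A * τ r * T ^ (1 / γ) := h1
      _ ≤ A * τ (r * t) * T ^ (1 / γ) := by gcongr
      _ = τ (r * t) * (A * T ^ (1 / γ)) := by ring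
      _ ≤ (τ (r * t) + 1) * N := by gcongr; linarith

theorem exists_growth_exponents {σ τ : ℝ → ℝ} (h : upperIndex τ < lowerIndex σ) :
    ∃ γ₁ γ₂ : ℝ, 0 < γ₁ ∧ γ₁ < γ₂ ∧ PropPbar τ γ₁ ∧ PropP σ γ₂ := by
  obtain ⟨_, ⟨γ₁, ⟨h₁, hP₁⟩, rfl⟩, h⟩ := sInf_lt_iff.1 h
  obtain ⟨_, ⟨γ₂, ⟨h₂, hP₂⟩, rfl⟩, h⟩ := lt_sSup_iff.1 h
  exact ⟨γ₁, γ₂, h₁, (ENNReal.ofReal_lt_ofReal_iff h₂).1 h, hP₁, hP₂⟩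

/-- By a sufficiently large dilation `τ` can be made to dominate every multiple of `σ`. -/
def DilationDominated (σ τ : ℝ → ℝ) : Prop :=
  ∀ k α β : ℝ, 1 ≤ k → 0 < α → 0 < β → ∃ μ L D : ℝ, 1 ≤ μ ∧ 0 < L ∧ ∀ s u : ℝ, 0 ≤ s → 0 ≤ u →
    σ (k * (μ * s)) - α * τ (μ * u) ≤ L * (σ s - β * τ u) + D

/-- The dilation multiplies σ by at most L = C(kμ)^a and τ by at least cμ^b, up to additive
constants. Since a < b, a large μ achieves βL ≤ αcμ^b. -/
theorem dilationDominated_of_growth {σ τ : ℝ → ℝ} (hτ : ∀ t, 0 ≤ t → 0 ≤ τ t) {a b C c : ℝ}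
    (hab : a < b) (hC : 0 < C) (hc : 0 < c)
    (hU : ∀ r t : ℝ, 1 ≤ r → 0 ≤ t → σ (r * t) ≤ C * r ^ a * (σ t + 1))
    (hL : ∀ r t : ℝ, 1 ≤ r → 0 ≤ t → c * r ^ b * τ t ≤ τ (r * t) + 1) :
    DilationDominated σ τ := by
  intro k α β hk hα hβ
  obtain ⟨μ, hμ, hμ1⟩ := (((tendsto_rpow_atTop (sub_pos.2 hab)).eventually_ge_atTop
    (β * C * k ^ a / (α * c))).and (eventually_ge_atTop 1)).exists
  have hk0 : 0 < k := by linarith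
  have hμ0 : 0 < μ := by linarith
  have hmain : β * (C * (k * μ) ^ a) ≤ α * (c * μ ^ b) := by
    rw [div_le_iff₀ (by positivity)] at hμ
    rw [Real.mul_rpow hk0.le hμ0.le]
    calc β * (C * (k ^ a * μ ^ a)) = β * C * k ^ a * μ ^ a := by ring
      _ ≤ μ ^ (b - a) * (α * c) * μ ^ a := by gcongr
      _ = α * (c * (μ ^ (b - a) * μ ^ a)) := by ring
      _ = α * (c * μ ^ b) := by rw [← Real.rpow_add hμ0, sub_add_cancel]
  refine ⟨μ, C * (k * μ) ^ a, C * (k * μ) ^ a + α, hμ1, by positivity, fun s u hs hu => ?_⟩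
  have h1 := hU (k * μ) s (one_le_mul_of_one_le_of_one_le hk hμ1) hs
  have h2 := mul_le_mul_of_nonneg_left (hL μ u hμ1 hu) hα.le
  have h3 := mul_le_mul_of_nonneg_right hmain (hτ u hu)
  rw [← mul_assoc]
  linarith

/-! ## The upper Legendre conjugate -/

theorem upperConj_le {f g : ℝ → ℝ} {t B : ℝ} (ht : 0 < t)
    (h : ∀ s, 0 ≤ s → f s - g (s / t) ≤ B) : upperConj f g t ≤ B := by
  rw [upperConj, if_neg ht.ne']
  exact ciSup_le fun s => h s s.2

theorem le_upperConj {f g : ℝ → ℝ} (h : UpperConjWellDefined f g) {s t : ℝ} (ht : 0 < t)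
    (hs : 0 ≤ s) : f s - g (s / t) ≤ upperConj f g t := by
  rw [upperConj, if_neg ht.ne']
  exact le_ciSup (h t ht) ⟨s, hs⟩

/-- Substitute s/(kμ) for s and s/(kμt) for u. The common dilation μ cancels in the quotient of the
two arguments, so only k survives in the argument of the conjugate. -/
theorem upperConj_comparison {f g f' g' : ℝ → ℝ} (h' : UpperConjWellDefined f' g')
    {k μ L D : ℝ} (hk : 0 < k) (hμ : 0 < μ) (hL : 0 < L)
    (h : ∀ s u : ℝ, 0 ≤ s → 0 ≤ u → f (k * (μ * s)) - g (μ * u) ≤ L * (f' s - g' u) + D) :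
    UpperConjWellDefined f g ∧
      ∀ t, 0 < t → upperConj f g (k * t) ≤ L * upperConj f' g' t + D := by
  have key : ∀ s t, 0 ≤ s → 0 < t → f s - g (s / (k * t)) ≤ L * upperConj f' g' t + D := by
    intro s t hs ht
    have h1 := h (s / (k * μ)) (s / (k * μ) / t) (by positivity) (by positivity)
    have e1 : k * (μ * (s / (k * μ))) = s := by field_simp
    have e2 : μ * (s / (k * μ) / t) = s / (k * t) := by field_simp
    rw [e1, e2] at h1
    refine h1.trans ?_
    gcongr
    exact le_upperConj h' ht (by positivity)
  refine ⟨fun t ht => ⟨L * upperConj f' g' (t / k) + D, ?_⟩,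
    fun t ht => upperConj_le (by positivity) fun s hs => key s t hs ht⟩
  rintro _ ⟨s, rfl⟩
  have := key s (t / k) s.2 (by positivity)
  rwa [mul_div_cancel₀ _ hk.ne'] at this

/-- The bound σ ≤ τ + D₀ controls only the conjugate at t = 1. Dilation domination with k = max 1 t
carries it to every t. -/
theorem upperConjWellDefined_of_le {σ τ : ℝ → ℝ} (hτ : MonotoneOn τ (Ici 0))
    (hd : DilationDominated σ τ) {D₀ : ℝ} (h : ∀ t, 0 ≤ t → σ t ≤ τ t + D₀) :
    UpperConjWellDefined σ τ := by
  intro t ht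
  have hk0 : 0 < max 1 t := lt_max_of_lt_left one_pos
  obtain ⟨μ, L, D, hμ, hL, hb⟩ := hd (max 1 t) 1 1 (le_max_left _ _) one_pos one_pos
  refine ⟨L * D₀ + D, ?_⟩
  rintro _ ⟨⟨s, hs⟩, rfl⟩
  have hs : 0 ≤ s := hs
  set k := max 1 t
  have h1 := hb (s / (k * μ)) (s / (k * μ)) (by positivity) (by positivity)
  have e1 : k * (μ * (s / (k * μ))) = s := by field_simp
  have e2 : μ * (s / (k * μ)) = s / k := by field_simp
  rw [e1, e2] at h1
  have h2 : τ (s / k) ≤ τ (s / t) := hτ (mem_Ici.2 (by positivity)) (mem_Ici.2 (by positivity))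
    (div_le_div_of_nonneg_left hs ht (le_max_right _ _))
  have h3 := mul_le_mul_of_nonneg_left (h (s / (k * μ)) (by positivity)) hL.le
  show σ s - τ (s / t) ≤ _
  linarith

theorem upperConj_nonneg {f g : ℝ → ℝ} (h : UpperConjWellDefined f g) (hf : f 0 = 0) (hg : g 0 = 0)
    {t : ℝ} (ht : 0 ≤ t) : 0 ≤ upperConj f g t := by
  rcases ht.eq_or_lt with rfl | ht
  · simp [upperConj, hf, hg]
  · simpa [hf, hg] using le_upperConj h ht le_rfl

theorem isWeightFunction_upperConj {f g : ℝ → ℝ} (h : UpperConjWellDefined f g) (hf : f 0 = 0)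
    (hg : g 0 = 0) (hmono : MonotoneOn g (Ici 0)) (hlog : Real.log =o[atTop] upperConj f g) :
    IsWeightFunction (upperConj f g) where
  nonneg t ht := upperConj_nonneg h hf hg ht
  monotoneOn := by
    intro t ht t' ht' htt'
    rcases (mem_Ici.1 ht).eq_or_lt with rfl | ht
    · have : upperConj f g 0 = 0 := by simp [upperConj, hf, hg]
      rw [this]
      exact upperConj_nonneg h hf hg ht'
    · refine upperConj_le ht fun s hs => ?_
      refine le_trans ?_ (le_upperConj h (ht.trans_le htt') hs)
      have := hmono (mem_Ici.2 (div_nonneg hs (ht.le.trans htt'))) (mem_Ici.2 (by positivity))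
        (div_le_div_of_nonneg_left hs ht htt')
      linarith
  tendsto := by
    refine tendsto_atTop_mono' _ ?_ Real.tendsto_log_atTop
    filter_upwards [hlog.def one_pos, eventually_ge_atTop 0] with t h1 h2
    rw [one_mul, Real.norm_of_nonneg (upperConj_nonneg h hf hg h2)] at h1
    exact (le_abs_self _).trans h1

theorem isLittleO_log_of_le {f : ℝ → ℝ}
    (h : ∀ x : ℝ, 0 < x → ∃ C, ∀ t, 0 < t → x * Real.log t - C ≤ f t) :
    Real.log =o[atTop] f := by
  refine isLittleO_iff.2 fun ε hε => ?_
  -- After multiplication by ε the slope 2/ε yields 2 log t; one of the two copies pays for Cε when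
  -- t is large.
  obtain ⟨C, hC⟩ := h (2 / ε) (by positivity)
  filter_upwards [Real.tendsto_log_atTop.eventually_ge_atTop (max 0 (C * ε)),
    eventually_gt_atTop 0] with t h1 h2
  have h0 : 0 ≤ Real.log t := (le_max_left _ _).trans h1
  rw [Real.norm_of_nonneg h0]
  refine le_trans ?_ (mul_le_mul_of_nonneg_left (le_abs_self (f t)) hε.le)
  have h3 := mul_le_mul_of_nonneg_left (hC t h2) hε.le
  have h4 : ε * (2 / ε * Real.log t - C) = 2 * Real.log t - C * ε := by field_simp
  linarith [(le_max_right _ _).trans h1]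

/-! ## Young conjugates -/

section Young

variable {f g : ℝ → ℝ}

theorem bddAbove_youngConj (hf : ∀ t, 0 < t → 0 ≤ f t) (hlog : Real.log =o[atTop] f) {x : ℝ}
    (hx : 0 ≤ x) : BddAbove (range fun y : ℝ => x * y - f (Real.exp y)) := by
  -- This constant gives (x + 1)y ≤ f(e^y) for large y, so the terms there are nonpositive; x + 1
  -- also covers x = 0.
  have hev := Real.tendsto_exp_atTop.eventually (hlog.def (show 0 < 1 / (x + 1) by positivity))
  obtain ⟨Y, hY⟩ := eventually_atTop.1 (hev.and (eventually_ge_atTop (0 : ℝ)))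
  have hY0 : 0 ≤ Y := (hY Y le_rfl).2
  refine ⟨x * Y, ?_⟩
  rintro _ ⟨y, rfl⟩
  have hfy := hf _ (Real.exp_pos y)
  rcases le_total Y y with h | h
  · obtain ⟨h1, h2⟩ := hY y h
    rw [Real.log_exp, Real.norm_of_nonneg h2, Real.norm_of_nonneg hfy, one_div_mul_eq_div,
      le_div_iff₀ (by positivity)] at h1
    have := mul_nonneg hx hY0
    simp only
    linarith
  · have := mul_le_mul_of_nonneg_left h hx
    simp only
    linarith

theorem le_youngConj (hf : ∀ t, 0 < t → 0 ≤ f t) (hlog : Real.log =o[atTop] f) {x : ℝ}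
    (hx : 0 ≤ x) (y : ℝ) : x * y - f (Real.exp y) ≤ youngConj f x :=
  le_ciSup (bddAbove_youngConj hf hlog hx) y

theorem youngConj_le {x B : ℝ} (h : ∀ y, x * y - f (Real.exp y) ≤ B) : youngConj f x ≤ B :=
  ciSup_le h

/-- Conjugation reverses inequalities. Shifting y by log k turns the dilation into the linear term x
log k, while the factor L rescales the argument of the conjugate. -/
theorem youngConj_dilation_le (hf : ∀ t, 0 < t → 0 ≤ f t) (hlog : Real.log =o[atTop] f)
    {k L D : ℝ} (hk : 0 < k) (hL : 0 < L) (h : ∀ t, 0 < t → f (k * t) ≤ L * g t + D) {x : ℝ}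
    (hx : 0 ≤ x) : x * Real.log k + L * youngConj g (x / L) - D ≤ youngConj f x := by
  have h1 : youngConj g (x / L) ≤ (youngConj f x + D - x * Real.log k) / L := by
    refine youngConj_le fun y => ?_
    rw [le_div_iff₀ hL]
    have h2 := le_youngConj hf hlog hx (y + Real.log k)
    rw [Real.exp_add, Real.exp_log hk, mul_comm _ k] at h2
    have h3 := h _ (Real.exp_pos y)
    have h4 : (x / L * y - g (Real.exp y)) * L = x * y - L * g (Real.exp y) := by field_simp
    rw [h4]
    linarith
  rw [le_div_iff₀ hL] at h1
  linarith

/-- At x = ℓp the linear term x log k becomes k^p after division by ℓ and exponentiation. With g = f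
this absorbs a geometric factor at the price of replacing ℓ by ℓ/L. -/
theorem pow_mul_assocMatrix_le (hf : ∀ t, 0 < t → 0 ≤ f t) (hlog : Real.log =o[atTop] f)
    {k L D : ℝ} (hk : 0 < k) (hL : 0 < L) (h : ∀ t, 0 < t → f (k * t) ≤ L * g t + D) {l : ℝ}
    (hl : 0 < l) (p : ℕ) :
    k ^ p * assocMatrix g (l / L) p ≤ Real.exp (D / l) * assocMatrix f l p := by
  have h1 := youngConj_dilation_le hf hlog hk hL h (x := l * p) (by positivity)
  rw [assocMatrix, assocMatrix, ← Real.exp_add, ← Real.rpow_natCast, Real.rpow_def_of_pos hk,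
    ← Real.exp_add, Real.exp_le_exp]
  have e1 : l / L * (p : ℝ) = l * p / L := by ring
  have e2 : Real.log k * p + 1 / (l / L) * youngConj g (l / L * p)
      = D / l + 1 / l * (l * p * Real.log k + L * youngConj g (l * p / L) - D) := by
    rw [e1]; field_simp; ring
  rw [e2]
  gcongr

theorem assocMatrix_pos (ω : ℝ → ℝ) (l : ℝ) (p : ℕ) : 0 < assocMatrix ω l p := Real.exp_pos _

/-- With k = 1 only the rescaling of ℓ by L remains. It is a bijection of the parameters, so it
serves the Roumieu and the Beurling quantifiers alike. -/
theorem functionWeights_le (hf : ∀ t, 0 < t → 0 ≤ f t) (hlog : Real.log =o[atTop] f)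
    {L D : ℝ} (hL : 0 < L) (h : ∀ t, 0 < t → f t ≤ L * g t + D) :
    WeightsLE (functionWeights g) (functionWeights f) := by
  have key := fun l (hl : 0 < l) (p : ℕ) =>
    pow_mul_assocMatrix_le (g := g) hf hlog one_pos hL (by simpa using h) hl p
  simp only [one_pow, one_mul] at key
  refine ⟨fun ⟨i, hi⟩ => ⟨⟨i * L, mul_pos hi hL⟩, Real.exp (D / (i * L)), fun p => ?_⟩,
    fun ⟨j, hj⟩ => ⟨⟨j / L, div_pos hj hL⟩, Real.exp (D / j), key j hj⟩⟩
  have := key (i * L) (mul_pos hi hL) p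
  rwa [mul_div_cancel_right₀ _ hL.ne'] at this

end Young

theorem IsBMTWeight.nonneg_of_pos {σ : ℝ → ℝ} (hσ : IsBMTWeight σ) (t : ℝ) (ht : 0 < t) : 0 ≤ σ t :=
  hσ.nonneg t ht.le

theorem IsBMTWeight.le_youngConj {σ : ℝ → ℝ} (hσ : IsBMTWeight σ) {x : ℝ} (hx : 0 ≤ x) (y : ℝ) :
    x * y - σ (Real.exp y) ≤ youngConj σ x :=
  UpperLegendre.le_youngConj hσ.nonneg_of_pos hσ.log_isLittleO hx y

theorem IsBMTWeight.youngConj_nonneg {σ : ℝ → ℝ} (hσ : IsBMTWeight σ) {x : ℝ} (hx : 0 ≤ x) :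
    0 ≤ youngConj σ x := by
  simpa [hσ.eq_zero 1 (by simp)] using hσ.le_youngConj hx 0

theorem IsBMTWeight.youngConj_zero {σ : ℝ → ℝ} (hσ : IsBMTWeight σ) : youngConj σ 0 = 0 :=
  le_antisymm (youngConj_le fun y => by simpa using hσ.nonneg _ (Real.exp_pos y).le)
    (hσ.youngConj_nonneg le_rfl)

theorem IsBMTWeight.youngConj_mono {σ : ℝ → ℝ} (hσ : IsBMTWeight σ) {x x' : ℝ} (hx : 0 ≤ x)
    (h : x ≤ x') : youngConj σ x ≤ youngConj σ x' := by
  refine youngConj_le fun y => ?_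
  rcases le_total 0 y with hy | hy
  · exact le_trans (by gcongr) (hσ.le_youngConj (hx.trans h) y)
  · have := hσ.nonneg _ (Real.exp_pos y).le
    have := hσ.youngConj_nonneg (hx.trans h)
    nlinarith

theorem IsBMTWeight.assocMatrix_zero {σ : ℝ → ℝ} (hσ : IsBMTWeight σ) (l : ℝ) :
    assocMatrix σ l 0 = 1 := by
  simp [assocMatrix, hσ.youngConj_zero]

/-- A weight function in `𝒲₀` is the conjugate of its Young conjugate. -/
theorem IsBMTWeight.exists_youngConj_le {σ : ℝ → ℝ} (hσ : IsBMTWeight σ) {y : ℝ} (hy : 0 ≤ y) :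
    ∃ x : ℝ, 0 ≤ x ∧ youngConj σ x ≤ x * y - σ (Real.exp y) := by
  set φ : ℝ → ℝ := fun y => σ (Real.exp y) with hφ
  have hmem : y ∈ interior (univ : Set ℝ) := by simp
  -- The right derivative is a subgradient of the convex φ at y, so the supremum defining φ*(x) is
  -- attained at y.
  set x := derivWithin φ (Ioi y) y with hx
  have hright : ∀ z, y < z → x * (z - y) ≤ φ z - φ y := fun z hz => by
    have := hσ.convexOn.rightDeriv_le_slope_of_mem_interior hmem (mem_univ z) hz
    rwa [slope_def_field, le_div_iff₀ (sub_pos.2 hz)] at this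
  have hleft : ∀ z, z < y → φ y - φ z ≤ x * (y - z) := fun z hz => by
    have h1 := hσ.convexOn.slope_le_leftDeriv_of_mem_interior (mem_univ z) hmem hz
    have h2 := h1.trans (hσ.convexOn.leftDeriv_le_rightDeriv_of_mem_interior hmem)
    rwa [slope_def_field, div_le_iff₀ (sub_pos.2 hz)] at h2
  refine ⟨x, ?_, youngConj_le fun z => ?_⟩
  · have h1 := hleft (y - 1) (by linarith)
    have h2 : φ (y - 1) ≤ φ y := hσ.monotoneOn (mem_Ici.2 (Real.exp_pos _).le)
      (mem_Ici.2 (Real.exp_pos _).le) (Real.exp_le_exp.2 (by linarith))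
    linarith
  · rcases lt_trichotomy z y with h | rfl | h
    · have := hleft z h
      simp only [hφ] at this
      linarith
    · exact le_rfl
    · have := hright z h
      simp only [hφ] at this
      linarith

/-! ## Associated functions of the associated matrix -/

section Assoc

variable {σ : ℝ → ℝ} {l : ℝ}

theorem log_pow_div_assocMatrix (σ : ℝ → ℝ) (l : ℝ) {t : ℝ} (ht : 0 < t) (p : ℕ) :
    Real.log (t ^ p / assocMatrix σ l p) = p * Real.log t - 1 / l * youngConj σ (l * p) := by
  rw [Real.log_div (by positivity) (assocMatrix_pos _ _ _).ne', Real.log_pow, assocMatrix,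
    Real.log_exp]

theorem IsBMTWeight.log_pow_div_assocMatrix_le (hσ : IsBMTWeight σ) (hl : 0 < l) {t : ℝ}
    (ht : 0 ≤ t) (p : ℕ) : Real.log (t ^ p / assocMatrix σ l p) ≤ σ t / l := by
  rcases ht.eq_or_lt with rfl | ht
  · rcases Nat.eq_zero_or_pos p with rfl | hp
    · simp [hσ.assocMatrix_zero, hσ.eq_zero 0 (by simp)]
    -- Here `Real.log 0 = 0` replaces −∞, which is harmless because σ(0) = 0.
    · simp [zero_pow hp.ne', hσ.eq_zero 0 (by simp)]
  · rw [log_pow_div_assocMatrix σ l ht, le_div_iff₀ hl]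
    have h := hσ.le_youngConj (x := l * p) (by positivity) (Real.log t)
    rw [Real.exp_log ht] at h
    have e : (p * Real.log t - 1 / l * youngConj σ (l * p)) * l
      = l * p * Real.log t - youngConj σ (l * p) := by field_simp
    linarith

theorem IsBMTWeight.bddAbove_assocFun (hσ : IsBMTWeight σ) (hl : 0 < l) {t : ℝ} (ht : 0 ≤ t) :
    BddAbove (range fun p : ℕ => Real.log (t ^ p / assocMatrix σ l p)) :=
  ⟨σ t / l, by rintro _ ⟨p, rfl⟩; exact hσ.log_pow_div_assocMatrix_le hl ht p⟩

theorem IsBMTWeight.assocFun_le (hσ : IsBMTWeight σ) (hl : 0 < l) {t : ℝ} (ht : 0 ≤ t) :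
    l * assocFun (assocMatrix σ l) t ≤ σ t := by
  rw [← le_div_iff₀' hl]
  exact ciSup_le fun p => hσ.log_pow_div_assocMatrix_le hl ht p

theorem IsBMTWeight.assocFun_nonneg (hσ : IsBMTWeight σ) (hl : 0 < l) {t : ℝ} (ht : 0 ≤ t) :
    0 ≤ assocFun (assocMatrix σ l) t := by
  simpa [hσ.assocMatrix_zero, assocFun] using le_ciSup (hσ.bddAbove_assocFun hl ht) 0

theorem IsBMTWeight.assocFun_zero (hσ : IsBMTWeight σ) (hl : 0 < l) :
    assocFun (assocMatrix σ l) 0 = 0 := by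
  have h := hσ.assocFun_le hl le_rfl
  rw [hσ.eq_zero 0 (by simp)] at h
  exact le_antisymm (nonpos_of_mul_nonpos_right h hl) (hσ.assocFun_nonneg hl le_rfl)

theorem IsBMTWeight.monotoneOn_assocFun (hσ : IsBMTWeight σ) (hl : 0 < l) :
    MonotoneOn (assocFun (assocMatrix σ l)) (Ici 0) := by
  intro t ht t' ht' htt'
  rcases (mem_Ici.1 ht).eq_or_lt with rfl | ht
  · rw [hσ.assocFun_zero hl]
    exact hσ.assocFun_nonneg hl ht'
  · refine ciSup_mono (hσ.bddAbove_assocFun hl ht') fun p => ?_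
    have := assocMatrix_pos σ l p
    exact Real.log_le_log (by positivity) (by gcongr)

/-- Biconjugation gives σ(t) ≤ x log t − φ*(x) for some x ≥ 0, whereas the associated function sees
only x in ℓℕ. Rounding x down to ℓp costs at most ℓ log t, which is at most σ(t)/2 for large t.
Absorbing this half produces the factor 2. -/
theorem IsBMTWeight.le_assocFun (hσ : IsBMTWeight σ) (hl : 0 < l) :
    ∃ D : ℝ, ∀ t, 0 ≤ t → σ t ≤ 2 * l * assocFun (assocMatrix σ l) t + D := by
  obtain ⟨T, hT⟩ := eventually_atTop.1
    ((hσ.log_isLittleO.def (show 0 < 1 / (2 * l) by positivity)).and (eventually_ge_atTop (1 : ℝ)))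
  have hT1 : 1 ≤ T := (hT T le_rfl).2
  have hσT : 0 ≤ σ T := hσ.nonneg T (by linarith)
  refine ⟨σ T, fun t ht => ?_⟩
  have hf := hσ.assocFun_nonneg hl ht
  rcases le_total t T with htT | htT
  · have : σ t ≤ σ T := hσ.monotoneOn (mem_Ici.2 ht) (mem_Ici.2 (by linarith)) htT
    have : 0 ≤ 2 * l * assocFun (assocMatrix σ l) t := by positivity
    linarith
  obtain ⟨h1, h2⟩ := hT t htT
  have ht0 : 0 < t := by linarith
  have hlog : 0 ≤ Real.log t := Real.log_nonneg h2
  rw [Real.norm_of_nonneg hlog, Real.norm_of_nonneg (hσ.nonneg t ht), one_div_mul_eq_div,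
    le_div_iff₀ (by positivity)] at h1
  obtain ⟨x, hx, hxt⟩ := hσ.exists_youngConj_le hlog
  rw [Real.exp_log ht0] at hxt
  set p := ⌊x / l⌋₊
  have hp : l * p ≤ x := by
    rw [← le_div_iff₀' hl]; exact Nat.floor_le (by positivity)
  have hp' : x ≤ l * (p + 1) := by
    rw [← div_le_iff₀' hl]; exact (Nat.lt_floor_add_one _).le
  have h3 : p * Real.log t - 1 / l * youngConj σ (l * p) ≤ assocFun (assocMatrix σ l) t := by
    rw [← log_pow_div_assocMatrix σ l ht0]
    exact le_ciSup (hσ.bddAbove_assocFun hl ht) p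
  have h4 := hσ.youngConj_mono (by positivity) hp
  have h5 : l * p * Real.log t - youngConj σ (l * p) ≤ l * assocFun (assocMatrix σ l) t := by
    calc _ = l * (p * Real.log t - 1 / l * youngConj σ (l * p)) := by field_simp
      _ ≤ _ := by gcongr
  have h6 := mul_le_mul_of_nonneg_right hp' hlog
  nlinarith

end Assoc

/-! ## Comparison of the quotient matrix with the upper Legendre conjugate -/

section Quotient

variable {σ τ : ℝ → ℝ}

/-- The definition gives σ(e^(w+y)) ≤ τ(e^w) + ω(e^y) with ω the upper conjugate; subtract from x(w
+ y) and take the supremum over w. For fixed x this says that ω dominates the logarithm, and the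
supremum over y compares the weight matrices. -/
theorem IsBMTWeight.add_youngConj_le (hσ : IsBMTWeight σ) (hwd : UpperConjWellDefined σ τ) {x : ℝ}
    (hx : 0 ≤ x) (y : ℝ) :
    x * y + youngConj τ x ≤ youngConj σ x + upperConj σ τ (Real.exp y) := by
  have h : youngConj τ x ≤ youngConj σ x + upperConj σ τ (Real.exp y) - x * y := by
    refine youngConj_le fun w => ?_
    have h1 := hσ.le_youngConj hx (w + y)
    have h2 := le_upperConj hwd (Real.exp_pos y) (Real.exp_pos (w + y)).le
    rw [← Real.exp_sub, add_sub_cancel_right] at h2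
    linarith
  linarith

theorem IsBMTWeight.log_isLittleO_upperConj (hσ : IsBMTWeight σ)
    (hwd : UpperConjWellDefined σ τ) : Real.log =o[atTop] upperConj σ τ := by
  refine isLittleO_log_of_le fun x hx => ⟨youngConj σ x - youngConj τ x, fun t ht => ?_⟩
  have := hσ.add_youngConj_le hwd hx.le (Real.log t)
  rw [Real.exp_log ht] at this
  linarith

theorem IsBMTWeight.assocMatrix_upperConj_le (hσ : IsBMTWeight σ)
    (hwd : UpperConjWellDefined σ τ) {l : ℝ} (hl : 0 < l) (p : ℕ) :
    assocMatrix (upperConj σ τ) l p ≤ assocMatrix σ l p / assocMatrix τ l p := by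
  rw [assocMatrix, assocMatrix, assocMatrix, ← Real.exp_sub, Real.exp_le_exp, ← mul_sub]
  gcongr
  refine youngConj_le fun y => ?_
  linarith [hσ.add_youngConj_le hwd (x := l * p) (by positivity) y]

theorem log_max_one_le {ε v : ℝ} (hε : 0 < ε) (hv : 0 ≤ v) :
    Real.log (max 1 v) ≤ ε * v + (ε + |Real.log ε|) := by
  have hX : 0 < max 1 v := lt_max_of_lt_left one_pos
  have h1 := Real.log_le_sub_one_of_pos (mul_pos hε hX)
  rw [Real.log_mul hε.ne' hX.ne'] at h1
  have h2 := neg_abs_le (Real.log ε)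
  have h3 : max 1 v ≤ 1 + v := max_le (by linarith) (by linarith)
  have h4 := mul_le_mul_of_nonneg_left h3 hε.le
  linarith

theorem IsBMTWeight.exists_apply_exp_eq (hτ : IsBMTWeight τ) {x : ℝ} (hx : 0 < x) :
    ∃ w, τ (Real.exp w) = x := by
  obtain ⟨T, hT, hT0⟩ :=
    ((hτ.tendsto.eventually_ge_atTop x).and (eventually_ge_atTop 0)).exists
  have h0 : τ 0 = 0 := hτ.eq_zero 0 (by simp)
  obtain ⟨t, ht, rfl⟩ := intermediate_value_Icc hT0
    (hτ.continuousOn.mono Icc_subset_Ici_self) (show x ∈ Icc (τ 0) (τ T) from ⟨h0.le.trans hx.le, hT⟩)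
  have ht0 : 0 < t := ht.1.lt_of_ne (by rintro rfl; exact hx.ne' h0)
  exact ⟨Real.log t, by rw [Real.exp_log ht0]⟩

/-- Test φ*_σ at a near-maximizer z and φ*_τ at a w with τ(e^w) = x; this reduces the claim to
bounding x(z − w) − σ(e^z). Then test φ*_ω(2x) at z − w − d. The shift d makes ω(e^(z−w−d)) at most
σ(e^z) + 1, yet grows only logarithmically in σ(e^z)/x. Half of σ(e^z) pays for xd, the other half
for the value of ω; hence the argument 2x and the factor 1/2. -/
theorem youngConj_sub_le (hσ : IsBMTWeight σ) (hτ : IsBMTWeight τ)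
    (hwd : UpperConjWellDefined σ τ) {a b C c : ℝ} (hab : a < b) (hb : 0 < b) (hC : 0 < C)
    (hc : 0 < c)
    (hU : ∀ r t : ℝ, 1 ≤ r → 0 ≤ t → σ (r * t) ≤ C * r ^ a * (σ t + 1))
    (hL : ∀ r t : ℝ, 1 ≤ r → 0 ≤ t → c * r ^ b * τ t ≤ τ (r * t) + 1) :
    ∃ H : ℝ, ∀ x : ℝ, 0 < x →
      youngConj σ x - youngConj τ x ≤ H * x + 2 + youngConj (upperConj σ τ) (2 * x) / 2 := by
  -- Chosen so that xεM/b = (A + 1)/2 with A and M as below.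
  set ε := b * c / (2 * C) with hε
  have hε0 : 0 < ε := by positivity
  refine ⟨1 + (ε + |Real.log ε|) / b, fun x hx => ?_⟩
  obtain ⟨z, hz⟩ := exists_lt_of_lt_ciSup (show youngConj σ x - 1 < youngConj σ x by linarith)
  obtain ⟨w, hw⟩ := hτ.exists_apply_exp_eq hx
  have hτw := hτ.le_youngConj hx.le w
  rw [hw] at hτw
  set A := σ (Real.exp z) with hA
  have hA0 : 0 ≤ A := hσ.nonneg _ (Real.exp_pos z).le
  -- M balances the two growth estimates: cMx = C(A + 1). The shift d then gives e^(db) = max 1 M,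
  -- the maximum keeping d nonnegative.
  set M := C * (A + 1) / (c * x) with hM
  have hM0 : 0 ≤ M := by positivity
  set d := Real.log (max 1 M) / b with hd
  have hd0 : 0 ≤ d := div_nonneg (Real.log_nonneg (le_max_left _ _)) hb.le
  have hdb : Real.exp d ^ b = max 1 M := by
    rw [← Real.exp_mul, hd, div_mul_cancel₀ _ hb.ne',
      Real.exp_log (lt_max_of_lt_left one_pos)]
  have hω : upperConj σ τ (Real.exp (z - w - d)) ≤ A + 1 := by
    refine upperConj_le (Real.exp_pos _) fun s hs => ?_
    -- For s ≤ e^z monotonicity bounds σ(s) by A. For s = r e^z with r ≥ 1, the argument of τ is r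
    -- e^d e^w, and since r^a ≤ r^b its growth compensates that of σ, leaving σ − τ ≤ 1.
    have hτs := hτ.nonneg (s / Real.exp (z - w - d)) (by positivity)
    rcases le_total s (Real.exp z) with hsz | hsz
    · have : σ s ≤ A := hσ.monotoneOn (mem_Ici.2 hs) (mem_Ici.2 (Real.exp_pos z).le) hsz
      linarith
    · obtain ⟨r, hr, rfl⟩ : ∃ r, 1 ≤ r ∧ s = r * Real.exp z :=
        ⟨s / Real.exp z, (one_le_div (Real.exp_pos z)).2 hsz, by field_simp⟩
      have hr0 : 0 < r := by linarith
      have e : r * Real.exp z / Real.exp (z - w - d) = r * Real.exp d * Real.exp w := by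
        rw [div_eq_iff (Real.exp_pos _).ne', mul_assoc, mul_assoc, ← Real.exp_add, ← Real.exp_add]
        congr 2
        ring
      have h1 := hU r (Real.exp z) hr (Real.exp_pos z).le
      have h2 := hL (r * Real.exp d) (Real.exp w)
        (one_le_mul_of_one_le_of_one_le hr (Real.one_le_exp hd0)) (Real.exp_pos w).le
      rw [hw, Real.mul_rpow hr0.le (Real.exp_pos d).le, hdb] at h2
      have h3 : C * r ^ a * (A + 1) ≤ c * (r ^ b * max 1 M) * x := by
        calc C * r ^ a * (A + 1) = c * (r ^ a * M) * x := by rw [hM]; field_simp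
          _ ≤ c * (r ^ b * max 1 M) * x := by
            gcongr
            exact le_max_right _ _
      rw [e]
      linarith
  have hωnn : ∀ t, 0 < t → 0 ≤ upperConj σ τ t := fun t ht =>
    upperConj_nonneg hwd (hσ.eq_zero 0 (by simp)) (hτ.eq_zero 0 (by simp)) ht.le
  have h4 := le_youngConj hωnn (hσ.log_isLittleO_upperConj hwd) (show 0 ≤ 2 * x by positivity)
    (z - w - d)
  have h5 : x * d ≤ (A + 1) / 2 + x * ((ε + |Real.log ε|) / b) := by
    have h6 : d ≤ (ε * M + (ε + |Real.log ε|)) / b := by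
      rw [hd]
      gcongr
      exact log_max_one_le hε0 hM0
    calc x * d ≤ x * ((ε * M + (ε + |Real.log ε|)) / b) := by gcongr
      _ = x * (ε * M / b) + x * ((ε + |Real.log ε|) / b) := by ring
      _ = _ := by
        congr 1
        rw [hε, hM]
        field_simp
  linarith

/-- At x = ℓp, division by ℓ turns φ*_ω(2x)/2 into the matrix row of index 2ℓ and the linear term
into a geometric factor whose base is independent of ℓ. -/
theorem exists_quotient_le (hσ : IsBMTWeight σ) (hτ : IsBMTWeight τ)
    (hwd : UpperConjWellDefined σ τ) {a b C c : ℝ} (hab : a < b) (hb : 0 < b) (hC : 0 < C)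
    (hc : 0 < c)
    (hU : ∀ r t : ℝ, 1 ≤ r → 0 ≤ t → σ (r * t) ≤ C * r ^ a * (σ t + 1))
    (hL : ∀ r t : ℝ, 1 ≤ r → 0 ≤ t → c * r ^ b * τ t ≤ τ (r * t) + 1) :
    ∃ H : ℝ, 0 < H ∧ ∀ l : ℝ, 0 < l → ∃ B : ℝ, ∀ p : ℕ,
      assocMatrix σ l p / assocMatrix τ l p
        ≤ B * (H ^ p * assocMatrix (upperConj σ τ) (2 * l) p) := by
  obtain ⟨H, hH⟩ := youngConj_sub_le hσ hτ hwd hab hb hC hc hU hL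
  refine ⟨Real.exp H, Real.exp_pos H, fun l hl => ?_⟩
  set W₀ := assocMatrix (upperConj σ τ) (2 * l) 0 with hW₀
  have hW₀pos : 0 < W₀ := assocMatrix_pos _ _ _
  -- The conjugate estimate requires x > 0, so p = 0 needs the separate constant 1/W₀.
  refine ⟨max (Real.exp (2 / l)) (1 / W₀), fun p => ?_⟩
  have hp0 : 0 ≤ Real.exp H ^ p * assocMatrix (upperConj σ τ) (2 * l) p :=
    mul_nonneg (by positivity) (assocMatrix_pos _ _ _).le
  rcases Nat.eq_zero_or_pos p with rfl | hp
  · refine le_trans ?_ (mul_le_mul_of_nonneg_right (le_max_right _ _) hp0)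
    rw [hσ.assocMatrix_zero, hτ.assocMatrix_zero, pow_zero, one_mul, ← hW₀,
      one_div_mul_cancel hW₀pos.ne', div_one]
  · refine le_trans ?_ (mul_le_mul_of_nonneg_right (le_max_left _ _) hp0)
    have hp' : (0 : ℝ) < p := by exact_mod_cast hp
    rw [assocMatrix, assocMatrix, assocMatrix, ← Real.exp_sub, ← Real.exp_nat_mul, ← Real.exp_add,
      ← Real.exp_add, Real.exp_le_exp, ← mul_sub, mul_assoc 2 l]
    calc 1 / l * (youngConj σ (l * p) - youngConj τ (l * p))
        ≤ 1 / l * (H * (l * p) + 2 + youngConj (upperConj σ τ) (2 * (l * p)) / 2) := by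
          gcongr
          exact hH _ (by positivity)
      _ = _ := by field_simp; ring

/-- The factor (hH)^p is absorbed by passing from index 2ℓ to 2ℓL. As L depends on h but not on ℓ,
the Beurling case can prescribe the target index j and solve for ℓ with h = 1. -/
theorem quotient_weightsLE {ω : ℝ → ℝ} {M : ℝ → ℕ → ℝ} (hω : ∀ t, 0 < t → 0 ≤ ω t)
    (hlog : Real.log =o[atTop] ω)
    (hdil : ∀ k : ℝ, 1 ≤ k → ∃ L D : ℝ, 0 < L ∧ ∀ t, 0 < t → ω (k * t) ≤ L * ω t + D)
    {H : ℝ} (hH : 0 < H) (hM : ∀ l : ℝ, 0 < l → ∃ B : ℝ, ∀ p : ℕ,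
      M l p ≤ B * (H ^ p * assocMatrix ω (2 * l) p)) (hMpos : ∀ l p, 0 < M l p) :
    WeightsLE (matrixWeights M) (functionWeights ω) := by
  have key : ∀ h : ℝ, 0 < h → ∃ L D : ℝ, 0 < L ∧ ∀ l : ℝ, 0 < l → ∀ p,
      h ^ p * assocMatrix ω (l / L) p ≤ Real.exp (D / l) * assocMatrix ω l p := by
    intro h hh
    obtain ⟨L, D, hL, hLD⟩ := hdil (max 1 h) (le_max_left _ _)
    refine ⟨L, D, hL, fun l hl p => ?_⟩
    refine le_trans ?_ (pow_mul_assocMatrix_le hω hlog (lt_max_of_lt_left one_pos) hL hLD hl p)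
    have := (assocMatrix_pos ω (l / L) p).le
    gcongr
    exact le_max_right _ _
  have main : ∀ h : ℝ, 0 < h → ∃ L : ℝ, 0 < L ∧ ∀ l : ℝ, 0 < l → ∃ B : ℝ, ∀ p,
      h ^ p * M l p ≤ B * assocMatrix ω (2 * l * L) p := by
    intro h hh
    obtain ⟨L, D, hL, hLD⟩ := key (h * H) (by positivity)
    refine ⟨L, hL, fun l hl => ?_⟩
    obtain ⟨B, hB⟩ := hM l hl
    have hB0 : 0 < B := by
      have h1 := (hMpos l 0).trans_le (hB 0)
      have := assocMatrix_pos ω (2 * l) 0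
      exact pos_of_mul_pos_left h1 (by positivity)
    refine ⟨B * Real.exp (D / (2 * l * L)), fun p => ?_⟩
    have h2 := hLD (2 * l * L) (by positivity) p
    rw [mul_div_cancel_right₀ _ hL.ne', mul_pow] at h2
    calc h ^ p * M l p ≤ h ^ p * (B * (H ^ p * assocMatrix ω (2 * l) p)) := by gcongr; exact hB p
      _ = B * (h ^ p * H ^ p * assocMatrix ω (2 * l) p) := by ring
      _ ≤ B * (Real.exp (D / (2 * l * L)) * assocMatrix ω (2 * l * L) p) := by gcongr
      _ = _ := by ring
  refine ⟨fun ⟨⟨l, hl⟩, ⟨h, hh⟩⟩ => ?_, fun ⟨j, hj⟩ => ?_⟩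
  · have hl : 0 < l := hl
    obtain ⟨L, hL, hLB⟩ := main h hh
    obtain ⟨B, hB⟩ := hLB l hl
    exact ⟨⟨2 * l * L, by rw [mem_Ioi]; positivity⟩, B, hB⟩
  · have hj : 0 < j := hj
    obtain ⟨L, hL, hLB⟩ := main 1 one_pos
    obtain ⟨B, hB⟩ := hLB (j / (2 * L)) (by positivity)
    refine ⟨⟨⟨j / (2 * L), by rw [mem_Ioi]; positivity⟩, ⟨1, mem_Ioi.2 one_pos⟩⟩, B, fun p => ?_⟩
    have e : 2 * (j / (2 * L)) * L = j := by field_simp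
    rw [e] at hB
    exact hB p

theorem weightsLE_quotient {ω : ℝ → ℝ} {M : ℝ → ℕ → ℝ} (hω : ∀ t, 0 < t → 0 ≤ ω t)
    (hlog : Real.log =o[atTop] ω)
    (hdil : ∀ k : ℝ, 1 ≤ k → ∃ L D : ℝ, 0 < L ∧ ∀ t, 0 < t → ω (k * t) ≤ L * ω t + D)
    (hM : ∀ l : ℝ, 0 < l → ∀ p : ℕ, assocMatrix ω l p ≤ M l p) :
    WeightsLE (functionWeights ω) (matrixWeights M) := by
  refine ⟨fun ⟨i, hi⟩ => ⟨⟨⟨i, hi⟩, ⟨1, mem_Ioi.2 one_pos⟩⟩, 1, fun p => ?_⟩, fun ⟨⟨l, hl⟩, ⟨h, hh⟩⟩ => ?_⟩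
  · simpa [functionWeights, matrixWeights] using hM i hi p
  · have hl : 0 < l := hl
    have hh : 0 < h := hh
    have hk0 : 0 < max 1 (1 / h) := lt_max_of_lt_left one_pos
    -- In the Beurling case h may be small; a dilation by at least 1/h compensates h^p.
    obtain ⟨L, D, hL, hLD⟩ := hdil (max 1 (1 / h)) (le_max_left _ _)
    refine ⟨⟨l / L, div_pos hl hL⟩, Real.exp (D / l), fun p => ?_⟩
    show assocMatrix ω (l / L) p ≤ Real.exp (D / l) * (h ^ p * M l p)
    have h1 := pow_mul_assocMatrix_le hω hlog hk0 hL hLD hl p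
    have h2 : 1 ≤ h ^ p * max 1 (1 / h) ^ p := by
      rw [← mul_pow]
      refine one_le_pow₀ ?_
      calc 1 = h * (1 / h) := by field_simp
        _ ≤ h * max 1 (1 / h) := by gcongr; exact le_max_right _ _
    have h3 := (assocMatrix_pos ω (l / L) p).le
    calc assocMatrix ω (l / L) p ≤ (h ^ p * max 1 (1 / h) ^ p) * assocMatrix ω (l / L) p :=
          le_mul_of_one_le_left h3 h2
      _ = h ^ p * (max 1 (1 / h) ^ p * assocMatrix ω (l / L) p) := by ring
      _ ≤ h ^ p * (Real.exp (D / l) * assocMatrix ω l p) := by gcongr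
      _ ≤ h ^ p * (Real.exp (D / l) * M l p) := by gcongr; exact hM l hl p
      _ = _ := by ring

end Quotient

/-! ### Consequences of the relations between sequences and between weight functions -/

theorem SeqPreceq.exists_le {M N : ℕ → ℝ} (h : SeqPreceq M N) (hM : ∀ p, 0 < M p)
    (hN : ∀ p, 0 < N p) : ∃ C B : ℝ, 0 < C ∧ ∀ p, M p ≤ B * (C ^ p * N p) := by
  obtain ⟨C, hC⟩ := h
  -- The relation says nothing about p = 0, so the outer constant must cover M₀/N₀.
  refine ⟨max C 1, max 1 (M 0 / N 0), lt_max_of_lt_right one_pos, fun p => ?_⟩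
  have hNp := hN p
  rcases Nat.eq_zero_or_pos p with rfl | hp
  · calc M 0 = M 0 / N 0 * N 0 := by field_simp
      _ ≤ max 1 (M 0 / N 0) * N 0 := by gcongr; exact le_max_right _ _
      _ = _ := by ring
  · have hq : 0 ≤ M p / N p := (div_pos (hM p) hNp).le
    have h1 : (M p / N p) ^ (1 / (p : ℝ)) ≤ max C 1 := (hC ⟨p, hp, rfl⟩).trans (le_max_left _ _)
    have h2 : M p / N p ≤ max C 1 ^ p := by
      calc M p / N p = ((M p / N p) ^ (1 / (p : ℝ))) ^ p := by
            rw [one_div, Real.rpow_inv_natCast_pow hq hp.ne']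
        _ ≤ max C 1 ^ p := pow_le_pow_left₀ (Real.rpow_nonneg hq _) h1 p
    rw [div_le_iff₀ hNp] at h2
    refine h2.trans (le_mul_of_one_le_left ?_ (le_max_left _ _))
    positivity

/-- The factor C^p is absorbed by the free geometric parameter, with ℓ unchanged. -/
theorem matrixWeights_le {M N : ℝ → ℕ → ℝ}
    (h : ∀ l : ℝ, 0 < l → ∃ C B : ℝ, 0 < C ∧ ∀ p, M l p ≤ B * (C ^ p * N l p)) :
    WeightsLE (matrixWeights M) (matrixWeights N) := by
  refine ⟨fun ⟨⟨l, hl⟩, ⟨k, hk⟩⟩ => ?_, fun ⟨⟨l, hl⟩, ⟨k, hk⟩⟩ => ?_⟩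
  · have hk : 0 < k := hk
    obtain ⟨C, B, hC, h⟩ := h l hl
    refine ⟨⟨⟨l, hl⟩, ⟨k * C, mul_pos hk hC⟩⟩, B, fun p => ?_⟩
    show k ^ p * M l p ≤ B * ((k * C) ^ p * N l p)
    calc k ^ p * M l p ≤ k ^ p * (B * (C ^ p * N l p)) := by gcongr; exact h p
      _ = _ := by ring
  · have hk : 0 < k := hk
    obtain ⟨C, B, hC, h⟩ := h l hl
    refine ⟨⟨⟨l, hl⟩, ⟨k / C, div_pos hk hC⟩⟩, B, fun p => ?_⟩
    show (k / C) ^ p * M l p ≤ B * (k ^ p * N l p)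
    calc (k / C) ^ p * M l p ≤ (k / C) ^ p * (B * (C ^ p * N l p)) := by gcongr; exact h p
      _ = B * (((k / C) * C) ^ p * N l p) := by rw [mul_pow]; ring
      _ = _ := by rw [div_mul_cancel₀ _ hC.ne']

theorem WeightTriangle.exists_le {σ τ : ℝ → ℝ} (h : WeightTriangle τ σ) (hσ : IsWeightFunction σ)
    (hτ : IsWeightFunction τ) : ∃ D : ℝ, ∀ t, 0 ≤ t → σ t ≤ τ t + D := by
  obtain ⟨T, hT⟩ := eventually_atTop.1 ((h.def one_pos).and (eventually_ge_atTop 0))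
  have hT0 : 0 ≤ T := (hT T le_rfl).2
  have hσT := hσ.nonneg T hT0
  refine ⟨σ T, fun t ht => ?_⟩
  have hτt := hτ.nonneg t ht
  rcases le_total t T with htT | htT
  · linarith [hσ.monotoneOn (mem_Ici.2 ht) (mem_Ici.2 hT0) htT]
  · have := (hT t htT).1
    rw [one_mul, Real.norm_of_nonneg hτt, Real.norm_of_nonneg (hσ.nonneg t ht)] at this
    linarith

/-! ### Stability of the upper conjugate under passage to associated functions -/

section AssocConj

variable {σ τ : ℝ → ℝ} {l : ℝ}

/-- Dilation domination compensates the mismatched factors in ℓω_S ≤ σ and τ ≤ 2ℓω_T + D': the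
factor 2 leaves only τ/2 to subtract, hence α = 1/2 and β = 1. -/
theorem DilationDominated.upperConj_assocFun_le (hd : DilationDominated σ τ) (hσ : IsBMTWeight σ)
    (hτ : IsBMTWeight τ) (hwd : UpperConjWellDefined σ τ) (hl : 0 < l) :
    UpperConjWellDefined (assocFun (assocMatrix σ l)) (assocFun (assocMatrix τ l)) ∧
      ∃ L D : ℝ, 0 < L ∧ ∀ t, 0 < t →
        upperConj (assocFun (assocMatrix σ l)) (assocFun (assocMatrix τ l)) t
          ≤ L * upperConj σ τ t + D := by
  obtain ⟨μ, L, D, hμ, hL, h⟩ := hd 1 (1 / 2) 1 le_rfl (by norm_num) one_pos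
  obtain ⟨D', hD'⟩ := hτ.le_assocFun hl
  have hμ0 : 0 < μ := by linarith
  have := upperConj_comparison (f := assocFun (assocMatrix σ l)) (g := assocFun (assocMatrix τ l))
    hwd one_pos hμ0 (L := L / l) (D := (D + D' / 2) / l) (by positivity) (fun s u hs hu => by
      have h1 := hσ.assocFun_le hl (t := μ * s) (by positivity)
      have h2 := hD' (μ * u) (by positivity)
      have h3 := h s u hs hu
      rw [one_mul] at h3 ⊢
      have e : L / l * (σ s - τ u) + (D + D' / 2) / l = (L * (σ s - τ u) + D + D' / 2) / l := by
        ring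
      rw [e, le_div_iff₀ hl]
      linarith)
  exact ⟨this.1, L / l, _, by positivity, by simpa using this.2⟩

/-- Now the factor 2 sits on the side of σ, in σ ≤ 2ℓω_S + D', so β = 2 is needed to make both terms
scale alike. -/
theorem DilationDominated.le_upperConj_assocFun (hd : DilationDominated σ τ) (hσ : IsBMTWeight σ)
    (hτ : IsBMTWeight τ) (hl : 0 < l)
    (hwd : UpperConjWellDefined (assocFun (assocMatrix σ l)) (assocFun (assocMatrix τ l))) :
    ∃ L D : ℝ, 0 < L ∧ ∀ t, 0 < t → upperConj σ τ t ≤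
      L * upperConj (assocFun (assocMatrix σ l)) (assocFun (assocMatrix τ l)) t + D := by
  obtain ⟨μ, L, D, hμ, hL, h⟩ := hd 1 1 2 le_rfl one_pos two_pos
  obtain ⟨D', hD'⟩ := hσ.le_assocFun hl
  have hμ0 : 0 < μ := by linarith
  have := upperConj_comparison (f := σ) (g := τ)
    hwd one_pos hμ0 (L := L * (2 * l)) (D := L * D' + D) (by positivity) (fun s u hs hu => by
      have h1 := hτ.assocFun_le hl hu
      have h2 := hD' s hs
      have h3 := h s u hs hu
      rw [one_mul] at h3 ⊢
      have h4 : L * (σ s - 2 * τ u) ≤ L * (2 * l * assocFun (assocMatrix σ l) s + D'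
          - 2 * (l * assocFun (assocMatrix τ l) u)) := by gcongr
      linarith)
  exact ⟨L * (2 * l), _, by positivity, by simpa using this.2⟩

theorem DilationDominated.upperConj_dilation_le (hd : DilationDominated σ τ)
    (hwd : UpperConjWellDefined σ τ) (k : ℝ) (hk : 1 ≤ k) :
    ∃ L D : ℝ, 0 < L ∧ ∀ t, 0 < t → upperConj σ τ (k * t) ≤ L * upperConj σ τ t + D := by
  obtain ⟨μ, L, D, hμ, hL, h⟩ := hd k 1 1 hk one_pos one_pos
  exact ⟨L, D, hL, (upperConj_comparison hwd (by linarith) (by linarith : 0 < μ) hL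
    (by simpa using h)).2⟩

end AssocConj

theorem isLittleO_log_of_comparison {f g : ℝ → ℝ} (hlog : Real.log =o[atTop] f)
    (hf : ∀ t, 0 < t → 0 ≤ f t) {L D : ℝ} (hL : 0 < L) (h : ∀ t, 0 < t → f t ≤ L * g t + D) :
    Real.log =o[atTop] g := by
  refine isLittleO_log_of_le fun x hx => ⟨(youngConj f (L * x) + D) / L, fun t ht => ?_⟩
  have h1 := le_youngConj hf hlog (x := L * x) (by positivity) (Real.log t)
  rw [Real.exp_log ht] at h1
  have h2 := h t ht
  rw [sub_le_iff_le_add, ← sub_le_iff_le_add', le_div_iff₀ hL]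
  linarith

end UpperLegendre

theorem theorem5p16 (σ τ : ℝ → ℝ) (hσ : IsBMTWeight σ) (hτ : IsBMTWeight τ)
    (Q : ℝ → ℕ → ℝ)
    (hQpos : ∀ l : ℝ, 0 < l → ∀ p : ℕ, 0 < Q l p)
    (hQnorm : ∀ l : ℝ, 0 < l → IsNormalized (Q l))
    (hQconv : ∀ l : ℝ, 0 < l → IsLogConvex (Q l))
    (hQequiv : ∀ l : ℝ, 0 < l →
      SeqEquiv (Q l) (fun p => assocMatrix σ l p / assocMatrix τ l p))
    (hτσ : WeightTriangle τ σ)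
    (hindex : upperIndex τ < lowerIndex σ) :
    (UpperConjWellDefined σ τ ∧ IsWeightFunction (upperConj σ τ) ∧
      Real.log =o[atTop] upperConj σ τ) ∧
    ∀ l : ℝ, 0 < l →
      (UpperConjWellDefined (assocFun (assocMatrix σ l)) (assocFun (assocMatrix τ l)) ∧
        IsWeightFunction (upperConj (assocFun (assocMatrix σ l)) (assocFun (assocMatrix τ l))) ∧
        Real.log =o[atTop]
          upperConj (assocFun (assocMatrix σ l)) (assocFun (assocMatrix τ l))) ∧
      ∀ (F : Setting) (c : ClassType),
        F.ofMatrix c (fun k p => assocMatrix σ k p / assocMatrix τ k p) = F.ofMatrix c Q ∧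
        F.ofMatrix c Q =
          F.ofFunction c (upperConj (assocFun (assocMatrix σ l)) (assocFun (assocMatrix τ l))) ∧
        F.ofFunction c (upperConj (assocFun (assocMatrix σ l)) (assocFun (assocMatrix τ l))) =
          F.ofFunction c (upperConj σ τ) := by
  obtain ⟨γ₁, γ₂, hγ₁, hγ, hP₁, hP₂⟩ := exists_growth_exponents hindex
  have hγ₂ : 0 < γ₂ := hγ₁.trans hγ
  obtain ⟨C, hC, hU⟩ := growth_upper hσ.toIsWeightFunction hγ₂ hP₂
  obtain ⟨c, hc, hL⟩ := growth_lower hτ hγ₁ hP₁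
  have hab : 1 / γ₂ < 1 / γ₁ := one_div_lt_one_div_of_lt hγ₁ hγ
  have hd : DilationDominated σ τ := dilationDominated_of_growth hτ.nonneg hab hC hc hU hL
  -- The relation between τ and σ enters through finiteness of the conjugate at t = 1; the growth
  -- estimates do the rest.
  obtain ⟨D₀, hD₀⟩ := hτσ.exists_le hσ.toIsWeightFunction hτ.toIsWeightFunction
  have hwd : UpperConjWellDefined σ τ := upperConjWellDefined_of_le hτ.monotoneOn hd hD₀
  have hlog := hσ.log_isLittleO_upperConj hwd
  have hω := isWeightFunction_upperConj hwd (hσ.eq_zero 0 (by simp)) (hτ.eq_zero 0 (by simp))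
    hτ.monotoneOn hlog
  have hωnn : ∀ t, 0 < t → 0 ≤ upperConj σ τ t := fun t ht => hω.nonneg t ht.le
  refine ⟨⟨hwd, hω, hlog⟩, fun l hl => ?_⟩
  obtain ⟨hwd', L₁, D₁, hL₁, h₁⟩ := hd.upperConj_assocFun_le hσ hτ hwd hl
  obtain ⟨L₂, D₂, hL₂, h₂⟩ := hd.le_upperConj_assocFun hσ hτ hl hwd'
  -- Domination of the logarithm is inherited from the conjugate of σ and τ, which is bounded by a
  -- multiple of the present one plus a constant.
  have hlog' := isLittleO_log_of_comparison hlog hωnn hL₂ h₂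
  have hω' := isWeightFunction_upperConj hwd' (hσ.assocFun_zero hl) (hτ.assocFun_zero hl)
    (hτ.monotoneOn_assocFun hl) hlog'
  refine ⟨⟨hwd', hω', hlog'⟩, fun F c => ?_⟩
  have hdil := hd.upperConj_dilation_le hwd
  have hquot : ∀ k p, 0 < assocMatrix σ k p / assocMatrix τ k p := fun k p =>
    div_pos (assocMatrix_pos _ _ _) (assocMatrix_pos _ _ _)
  have hquotW : ∀ i p, 0 < matrixWeights (fun k p => assocMatrix σ k p / assocMatrix τ k p) i p :=
    fun i p => mul_pos (pow_pos i.2.2 p) (hquot _ _)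
  have hQW : ∀ i p, 0 < matrixWeights Q i p := fun i p =>
    mul_pos (pow_pos i.2.2 p) (hQpos _ i.1.2 p)
  have hfun : ∀ (f : ℝ → ℝ) (i : Ioi (0 : ℝ)) (p : ℕ), 0 < functionWeights f i p :=
    fun f i p => assocMatrix_pos _ _ _
  obtain ⟨H, hH, hHB⟩ := exists_quotient_le hσ hτ hwd hab (by positivity) hC hc hU hL
  have hAQ : F.ofMatrix c (fun k p => assocMatrix σ k p / assocMatrix τ k p) = F.ofMatrix c Q :=
    F.space_eq c hquotW hQW
      (matrixWeights_le fun k hk => (hQequiv k hk).2.exists_le (hquot k) (hQpos k hk))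
      (matrixWeights_le fun k hk => (hQequiv k hk).1.exists_le (hQpos k hk) (hquot k))
  have hAω : F.ofMatrix c (fun k p => assocMatrix σ k p / assocMatrix τ k p)
      = F.ofFunction c (upperConj σ τ) :=
    F.space_eq c hquotW (hfun _) (quotient_weightsLE hωnn hlog hdil hH hHB hquot)
      (weightsLE_quotient hωnn hlog hdil fun k hk p => hσ.assocMatrix_upperConj_le hwd hk p)
  have hωω : F.ofFunction c (upperConj (assocFun (assocMatrix σ l)) (assocFun (assocMatrix τ l)))
      = F.ofFunction c (upperConj σ τ) :=
    F.space_eq c (hfun _) (hfun _) (functionWeights_le hωnn hlog hL₂ h₂)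
      (functionWeights_le (fun t ht => hω'.nonneg t ht.le) hlog' hL₁ h₁)
  exact ⟨hAQ, hAQ.symm.trans (hAω.trans hωω.symm), hωω⟩
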